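/- \textbf{Setting.} Let $d\ge 1$, $n\ge 1$, $\delta\in(0,1/3)$. Let $(X,Y)$ be a random vector with law $P$ on $\mathbb R^d\times\mathbb R$, $P^X$ the law of $X$, $S_X\subset\mathbb R^d$ a Borel set with $X\in S_X$ almost surely, $Y$ integrable, and $g(x)=\mathbb E[Y\mid X=x]$. Assume that $\varepsilon=Y-g(X)$ is sub-Gaussian conditionally on $X$ with parameter $\sigma^2$, i.e. $\mathbb E[\varepsilon\mid X]=0$ and $\mathbb E[e^{t\varepsilon}\mid X]\le e^{t^2\sigma^2/2}$ almost surely for every $t\in\mathbb R$, and that $g$ is $L$-Lipschitz on $S_X$ for the Euclidean norm. Let $(X_1,Y_1),\dots,(X_n,Y_n)$ be i.i.d. with law $P$. A local map is a map $\mathcal V$ sending each $x\in S_X$ to a Borel set $\mathcal V(x)\subset S_X$ with $x\in\mathcal V(x)$; it may be random and depend on the whole sample. Its estimator is $$\hat g_{\mathcal V}(x)=\frac{\sum_{i=1}^nY_i\mathbf 1_{\mathcal V(x)}(X_i)}{\sum_{i=1}^n\mathbf 1_{\mathcal V(x)}(X_i)},\qquad 0/0=0 .$$ Write $P_n^X(A)=\frac1n\sum_{i=1}^n\mathbf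 1_A(X_i)$, $\lambda$ for Lebesgue measure, $\operatorname{diam}$ for the Euclidean diameter, and $L(V)$ for the smallest $K\ge0$ with $|g(x)-g(y)|\le K\|x-y\|$ for all $x,y\in V$. Assume that: (i) $\mathcal V$ is VC with dimension $v$: almost surely $\mathcal V(x)\in\mathcal A$ for all $x\in S_X$, where $\mathcal A$ is a deterministic class of Borel sets of $\mathbb R^d$ with VC dimension $v$, which satisfies the usual measurability condition of empirical process theory: for all $m$ and $e\in\mathbb R^m$, $z\mapsto\sup_{A\in\mathcal A}|\sum_{i\le m}e_i\mathbf 1_A(z_i)|$ is measurable on $(\mathbb R^d)^m$ for the completion of $(P^X)^{\otimes m}$; (ii) there is a function $\ell>0$ on $S_X$ such that, almost surely, $P^X(\mathcal V(x))\ge\ell(x)\lambda(\mathcal V(x))$ for all $x\in S_X$; (iii) almost surely, $n\max\big(P_n^X(\mathcal V(x)),P^X(\mathcal V(x))\big)\ge 8\log\big(4(2n+1)^v/\delta\big)$ for all $x\in S_X$; (iv) for some $\gamma>0$, almost surely, $\operatorname{diam}(\mathcal V(x))^d\le\gamma\,\lambda(\mathcal V(x))$ for all $x\in S_X$; (v)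 for constants $a_1,a_2>0$, almost surely, for all $x\in S_X$, $$a_1\Big(\frac{\log((n+1)^v/\delta)}{n}\Big)^{d/(d+2)}\le\lambda(\mathcal V(x))\le a_2\Big(\frac{\log((n+1)^v/\delta)}{n}\Big)^{d/(d+2)} .$$ \textbf{Theorem.} There is a constant $C>0$ that depends only on $a_1,a_2$ such that, in every such setting, with probability at least $1-3\delta$, for all $x\in S_X$, $$|\hat g_{\mathcal V}(x)-g(x)|\le C\Big(\sqrt{\tfrac{3\sigma^2}{\ell(x)}}+L(\mathcal V(x))\,\gamma^{1/d}\Big)\Big(\frac{\log((n+1)^v/\delta)}{n}\Big)^{1/(d+2)} .$$ If moreover $S_X$ is bounded and $\ell(x)\ge b>0$ for all $x\in S_X$, then with probability at least $1-3\delta$, $$\sup_{x\in S_X}|\hat g_{\mathcal V}(x)-g(x)|\le C\Big(\sqrt{\tfrac{3\sigma^2}{b}}+L\,\gamma^{1/d}\Big)\Big(\frac{\log((n+1)^v/\delta)}{n}\Big)^{1/(d+2)} .$$ (Here "with probability at least $p$" means that the property holds on some measurable event of probability at least $p$.) -/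

import Mathlib

open MeasureTheory ProbabilityTheory
open scoped ENNReal NNReal

namespace LocalMapRegression

noncomputable section

/-! ### Regression model

`P` is the law on `ℝ^d × ℝ` of the pair `(X, Y)`; the two coordinate projections on the
probability space `(ℝ^d × ℝ, P)` play the role of `X` and `Y`. -/

/-- `g` is a version of the regression function `x ↦ E[Y | X = x]` under the law `P`. -/
def IsRegressionFunction {d : ℕ} (P : Measure (EuclideanSpace ℝ (Fin d) × ℝ))
    (g : EuclideanSpace ℝ (Fin d) → ℝ) : Prop :=
  Integrable (fun p => p.2) P ∧
    P[fun p => p.2 | MeasurableSpace.comap Prod.fst inferInstance] =ᵐ[P] fun p => g p.1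

/-- The noise `ε = Y - g(X)` is sub-Gaussian conditionally on `X` with parameter `σ²`:
`E[ε | X] = 0` and `E[exp(t ε) | X] ≤ exp(t² σ² / 2)` almost surely, for every real `t`.
Integrability is part of the claim, since `condExp` is `0` on non-integrable functions. -/
def CondSubGaussianNoise {d : ℕ} (P : Measure (EuclideanSpace ℝ (Fin d) × ℝ))
    (g : EuclideanSpace ℝ (Fin d) → ℝ) (σ : ℝ) : Prop :=
  Integrable (fun p => p.2 - g p.1) P ∧
  P[fun p => p.2 - g p.1 | MeasurableSpace.comap Prod.fst inferInstance] =ᵐ[P] 0 ∧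
  ∀ t : ℝ, Integrable (fun p => Real.exp (t * (p.2 - g p.1))) P ∧
    P[fun p => Real.exp (t * (p.2 - g p.1)) | MeasurableSpace.comap Prod.fst inferInstance]
      ≤ᵐ[P] fun _ => Real.exp (t ^ 2 * σ ^ 2 / 2)

/-- The sample `(X₁, Y₁), …, (Xₙ, Yₙ)` is independent and identically distributed with law `P`. -/
def IsIIDSample {d n : ℕ} {Ω : Type*} [MeasurableSpace Ω] (μ : Measure Ω)
    (P : Measure (EuclideanSpace ℝ (Fin d) × ℝ))
    (X : Fin n → Ω → EuclideanSpace ℝ (Fin d)) (Y : Fin n → Ω → ℝ) : Prop :=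
  iIndepFun (fun i ω => (X i ω, Y i ω)) μ ∧ ∀ i, HasLaw (fun ω => (X i ω, Y i ω)) P μ

/-! ### Local maps and their estimators -/

/-- A local map on `S`: every `x ∈ S` is sent to a Borel subset of `S` that contains `x`. -/
def IsLocalMap {d : ℕ} (S : Set (EuclideanSpace ℝ (Fin d)))
    (V : EuclideanSpace ℝ (Fin d) → Set (EuclideanSpace ℝ (Fin d))) : Prop :=
  ∀ x ∈ S, x ∈ V x ∧ V x ⊆ S ∧ MeasurableSet (V x)

/-- Number of sample points in `A`. -/
def count {d n : ℕ} (X : Fin n → EuclideanSpace ℝ (Fin d))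
    (A : Set (EuclideanSpace ℝ (Fin d))) : ℝ :=
  ∑ i, A.indicator (fun _ => (1 : ℝ)) (X i)

/-- Empirical measure of `A`. -/
def empiricalMeasure {d n : ℕ} (X : Fin n → EuclideanSpace ℝ (Fin d))
    (A : Set (EuclideanSpace ℝ (Fin d))) : ℝ :=
  count X A / n

/-- The local regression estimator: the average of the responses whose covariates lie in the
local set `V x`, with the convention `0 / 0 = 0`. -/
def estimator {d n : ℕ} (X : Fin n → EuclideanSpace ℝ (Fin d)) (Y : Fin n → ℝ)
    (V : EuclideanSpace ℝ (Fin d) → Set (EuclideanSpace ℝ (Fin d)))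
    (x : EuclideanSpace ℝ (Fin d)) : ℝ :=
  (∑ i, Y i * (V x).indicator (fun _ => (1 : ℝ)) (X i)) / count X (V x)

/-- The local Lipschitz constant of `g` over `V`. -/
def localLipschitzConst {d : ℕ} (g : EuclideanSpace ℝ (Fin d) → ℝ)
    (V : Set (EuclideanSpace ℝ (Fin d))) : ℝ :=
  sInf {K : ℝ | 0 ≤ K ∧ ∀ x ∈ V, ∀ y ∈ V, |g x - g y| ≤ K * ‖x - y‖}

/-! ### Vapnik-Chervonenkis classes -/

/-- The shattering coefficient: the largest number of different traces that the sets of `𝒜` leave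
on `m` distinct points. A trace is recorded as the set of indices of the points in `A`, which is
the same as its vector of indicators in `{0,1}^m`. -/
def shatteringCoeff {d : ℕ} (𝒜 : Set (Set (EuclideanSpace ℝ (Fin d)))) (m : ℕ) : ℕ :=
  ⨆ z : {z : Fin m → EuclideanSpace ℝ (Fin d) // Function.Injective z},
    ((fun A : Set (EuclideanSpace ℝ (Fin d)) => {i : Fin m | z.1 i ∈ A}) '' 𝒜).ncard

/-- The VC dimension `max {m ≥ 1 : shatteringCoeff 𝒜 m = 2 ^ m}`, which is `0` if no `m ≥ 1`
qualifies and `⊤` if the set is unbounded. -/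
def vcDim {d : ℕ} (𝒜 : Set (Set (EuclideanSpace ℝ (Fin d)))) : ℕ∞ :=
  ⨆ m : {m : ℕ // 1 ≤ m ∧ shatteringCoeff 𝒜 m = 2 ^ m}, (m.1 : ℕ∞)

/-- The usual measurability requirement on a class of sets indexing an empirical process under
the law `Q`: its members are Borel, and for all weights `e` the supremum over the class of
`|∑ e i * 1_A (z i)|` is a measurable function of `z` for the completion of `Q^m`. -/
def IsMeasurableClass {d : ℕ} (Q : Measure (EuclideanSpace ℝ (Fin d)))
    (𝒜 : Set (Set (EuclideanSpace ℝ (Fin d)))) : Prop :=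
  (∀ A ∈ 𝒜, MeasurableSet A) ∧
  ∀ (m : ℕ) (e : Fin m → ℝ),
    AEMeasurable (fun z : Fin m → EuclideanSpace ℝ (Fin d) =>
      ⨆ A : 𝒜, |∑ i, e i * (A : Set (EuclideanSpace ℝ (Fin d))).indicator (fun _ => (1 : ℝ)) (z i)|)
      (Measure.pi fun _ => Q)

/-- The random local map `V` is VC with dimension `v`: almost surely, all its values lie in one
deterministic class of VC dimension `v`. -/
def IsVCLocalMap {d : ℕ} {Ω : Type*} [MeasurableSpace Ω] (μ : Measure Ω)
    (Q : Measure (EuclideanSpace ℝ (Fin d))) (S : Set (EuclideanSpace ℝ (Fin d)))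
    (V : Ω → EuclideanSpace ℝ (Fin d) → Set (EuclideanSpace ℝ (Fin d))) (v : ℕ) : Prop :=
  ∃ 𝒜 : Set (Set (EuclideanSpace ℝ (Fin d))), vcDim 𝒜 = v ∧ IsMeasurableClass Q 𝒜 ∧
    ∀ᵐ ω ∂μ, ∀ x ∈ S, V ω x ∈ 𝒜

/-! ### Conditions on the cells -/

/-- The minimal mass assumption with weight `ℓ`, where `Q` is the law of the covariates. -/
def MinimalMass {d : ℕ} {Ω : Type*} [MeasurableSpace Ω] (μ : Measure Ω)
    (Q : Measure (EuclideanSpace ℝ (Fin d))) (S : Set (EuclideanSpace ℝ (Fin d)))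
    (V : Ω → EuclideanSpace ℝ (Fin d) → Set (EuclideanSpace ℝ (Fin d)))
    (ℓ : EuclideanSpace ℝ (Fin d) → ℝ) : Prop :=
  (∀ x ∈ S, 0 < ℓ x) ∧
    ∀ᵐ ω ∂μ, ∀ x ∈ S, ENNReal.ofReal (ℓ x) * volume (V ω x) ≤ Q (V ω x)

/-- The `(δ, n)`-largeness of a local map of VC dimension `v`. -/
def IsLarge {d n : ℕ} {Ω : Type*} [MeasurableSpace Ω] (μ : Measure Ω)
    (Q : Measure (EuclideanSpace ℝ (Fin d))) (S : Set (EuclideanSpace ℝ (Fin d)))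
    (X : Fin n → Ω → EuclideanSpace ℝ (Fin d))
    (V : Ω → EuclideanSpace ℝ (Fin d) → Set (EuclideanSpace ℝ (Fin d)))
    (v : ℕ) (δ : ℝ) : Prop :=
  ∀ᵐ ω ∂μ, ∀ x ∈ S,
    8 * Real.log (4 * (2 * (n : ℝ) + 1) ^ v / δ) ≤
      n * max (empiricalMeasure (fun i => X i ω) (V ω x)) (Q.real (V ω x))

/-- A set is `γ`-shape-regular if `diam(V)^d ≤ γ λ(V)`, with values in `[0, ∞]`. -/
def IsShapeRegular {d : ℕ} (γ : ℝ) (V : Set (EuclideanSpace ℝ (Fin d))) : Prop :=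
  Metric.ediam V ^ d ≤ ENNReal.ofReal γ * volume V

/-- The quantity `log((n+1)^v / δ) / n`. -/
def logRatio (n v : ℕ) (δ : ℝ) : ℝ :=
  Real.log (((n : ℝ) + 1) ^ v / δ) / n

/-- The event described by `A` has probability at least `p`: it contains a measurable event of
probability at least `p`. -/
def WithProbAtLeast {Ω : Type*} [MeasurableSpace Ω] (μ : Measure Ω) (p : ℝ) (A : Ω → Prop) : Prop :=
  ∃ G : Set Ω, MeasurableSet G ∧ ENNReal.ofReal p ≤ μ G ∧ ∀ ω ∈ G, A ω

end

end LocalMapRegression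

/-!
The error of a local average at `x` splits into a bias and a noise term.

*Bias.* All averaged points lie in `V x`, so the bias is at most the local Lipschitz constant times
the diameter, and shape regularity turns the volume bound `r ^ (d / (d + 2))` into a diameter of
order `r ^ (1 / (d + 2))` (`norm_sub_le_of_isShapeRegular`).

*Noise.* A set of the class acts on the sample only through its trace, the set of indices of the
sample points it contains, and by the Sauer-Shelah lemma there are at most `(n + 1) ^ v` traces
(`card_traces_le`). Conditionally on the covariates, the noise sum over each trace is sub-Gaussian,
and a union bound over the realised traces gives `|∑ ε| ≤ √(2 σ² N Λ)` for all of them at once, where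
`N` is the number of points in the set and `Λ = log(2 (n + 1) ^ v / δ)`
(`measure_exists_trace_noise_le`). The conditioning is carried out by comparing measures: weighting
the law of `(X, Y)` by `exp (t ε)` and projecting to the covariates gives a measure dominated by
`exp (t² σ² / 2)` times the law of `X`.

*Local sample size.* The noise term is of order `√(σ² Λ / N)`, so `N` must be at least of order
`n P(V x) ≥ n ℓ(x) λ(V x)`. This is a one-sided relative deviation inequality of Vapnik and
Chervonenkis (`measure_exists_count_lt_le`), proved by symmetrization: the sample is compared with a
ghost sample, and the pairs of a point and its ghost are exchanged at random. An exponential weight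
on traces whose average over the exchanges is at most `1` (`sum_swapWeight_le`) replaces a tail bound
for the exchanges.

*Measurability.* The local map need not be measurable in the sample, so every bound concerns outer
measures. Only the exchange argument and the union bound over realised traces need measurable
events, namely "`t` is a trace of the class on the sample" for a fixed nonempty `t`. This is
extracted from the measurability of suprema of absolute weighted sums, using weights that single out
`t` (`mem_traces_iff_iSup_eq`).
-/

namespace LocalMapRegression

/-! ### Traces of a class of sets on a finite sample -/

/-- The traces that the sets of `𝒜` leave on the finite family of points `z`, each recorded as the
finite set of indices `i` with `z i ∈ A`. The points may coincide. -/
noncomputable def traces {ι α : Type*} [Fintype ι] (𝒜 : Set (Set α)) (z : ι → α) :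
    Finset (Finset ι) :=
  open Classical in {t | ∃ A ∈ 𝒜, ∀ i, i ∈ t ↔ z i ∈ A}

lemma mem_traces {ι α : Type*} [Fintype ι] {𝒜 : Set (Set α)} {z : ι → α} {t : Finset ι} :
    t ∈ traces 𝒜 z ↔ ∃ A ∈ 𝒜, ∀ i, i ∈ t ↔ z i ∈ A := by
  simp [traces]

lemma mem_traces_comp_equiv {ι κ α : Type*} [Fintype ι] [Fintype κ] {𝒜 : Set (Set α)}
    (e : ι ≃ κ) (z : κ → α) (t : Finset κ) :
    t.map e.symm.toEmbedding ∈ traces 𝒜 (z ∘ e) ↔ t ∈ traces 𝒜 z := by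
  rw [mem_traces, mem_traces]
  refine exists_congr fun A => and_congr_right fun _ => ?_
  rw [e.forall_congr_left]
  simp

lemma shatteringCoeff_le {d : ℕ} (𝒜 : Set (Set (EuclideanSpace ℝ (Fin d)))) (m : ℕ) :
    shatteringCoeff 𝒜 m ≤ 2 ^ m := by
  refine ciSup_le' fun z => ?_
  refine (Set.ncard_le_ncard (Set.subset_univ _)).trans ?_
  simp [Set.ncard_univ]

/-- An index set on which all traces are realised indexes distinct points, so its size is at most
the VC dimension. -/
lemma card_le_of_shatters {d : ℕ} {ι : Type*} [Fintype ι] [DecidableEq ι]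
    {𝒜 : Set (Set (EuclideanSpace ℝ (Fin d)))} {v : ℕ} (hv : vcDim 𝒜 = v)
    (z : ι → EuclideanSpace ℝ (Fin d)) {s : Finset ι} (hs : (traces 𝒜 z).Shatters s) :
    s.card ≤ v := by
  rcases Nat.eq_zero_or_pos s.card with h0 | h0
  · omega
  let e := s.equivFin.symm
  have hinj : Function.Injective fun k => z (e k) := by
    intro i j hij
    by_contra hne
    obtain ⟨t, ht, hst⟩ := hs.exists_inter_eq_singleton (e i).2
    obtain ⟨A, -, hA⟩ := mem_traces.1 ht
    have h1 : (e i : ι) ∈ t := by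
      have : (e i : ι) ∈ s ∩ t := by rw [hst]; simp
      exact (Finset.mem_inter.1 this).2
    have h2 : (e j : ι) ∈ t := by
      rw [hA] at h1 ⊢
      simpa only [hij] using h1
    have h3 : (e j : ι) ∈ s ∩ t := Finset.mem_inter.2 ⟨(e j).2, h2⟩
    rw [hst, Finset.mem_singleton] at h3
    exact hne (e.injective (Subtype.ext h3)).symm
  have huniv : ((fun A : Set (EuclideanSpace ℝ (Fin d)) => {k | z (e k) ∈ A}) '' 𝒜) =
      Set.univ := by
    refine Set.eq_univ_of_forall fun B => ?_
    classical
    let B' : Finset ι := s.filter fun i => ∃ k, k ∈ B ∧ (e k : ι) = i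
    obtain ⟨t, ht, hst⟩ := hs (Finset.filter_subset (fun i => ∃ k, k ∈ B ∧ (e k : ι) = i) s)
    obtain ⟨A, hA, hAt⟩ := mem_traces.1 ht
    refine ⟨A, hA, ?_⟩
    ext k
    have hk : (e k : ι) ∈ s ∩ t ↔ (e k : ι) ∈ B' := by rw [hst]
    simp only [Finset.mem_inter, (e k).2, true_and, B', Finset.mem_filter] at hk
    rw [Set.mem_ofPred_eq, ← hAt, hk]
    constructor
    · rintro ⟨k', hk', hkk⟩
      rwa [← e.injective (Subtype.ext hkk)]
    · exact fun h => ⟨k, h, rfl⟩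
  have hcoeff : shatteringCoeff 𝒜 s.card = 2 ^ s.card := by
    refine le_antisymm (shatteringCoeff_le _ _) ?_
    have hbdd : BddAbove (Set.range fun z : {z : Fin s.card → EuclideanSpace ℝ (Fin d) //
        Function.Injective z} => ((fun A : Set (EuclideanSpace ℝ (Fin d)) =>
          {i : Fin s.card | z.1 i ∈ A}) '' 𝒜).ncard) := by
      refine ⟨2 ^ s.card, ?_⟩
      rintro _ ⟨z, rfl⟩
      refine (Set.ncard_le_ncard (Set.subset_univ _)).trans ?_
      simp [Set.ncard_univ]
    refine le_trans (le_of_eq ?_) (le_ciSup hbdd ⟨fun k => z (e k), hinj⟩)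
    simp only [huniv]
    simp [Set.ncard_univ]
  have := le_iSup (fun m : {m : ℕ // 1 ≤ m ∧ shatteringCoeff 𝒜 m = 2 ^ m} => (m.1 : ℕ∞))
    ⟨s.card, h0, hcoeff⟩
  change ((s.card : ℕ) : ℕ∞) ≤ vcDim 𝒜 at this
  rw [hv] at this
  exact_mod_cast this

lemma sum_choose_le_succ_pow (n v : ℕ) : ∑ k ∈ Finset.Iic v, n.choose k ≤ (n + 1) ^ v := by
  -- termwise comparison with the binomial expansion of `(n + 1) ^ v`
  have h1 : ∀ k ∈ Finset.Iic v, n.choose k ≤ n ^ k * v.choose k := by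
    intro k hk
    have : 0 < v.choose k := Nat.choose_pos (Finset.mem_Iic.1 hk)
    calc n.choose k ≤ n ^ k := Nat.choose_le_pow n k
      _ ≤ n ^ k * v.choose k := Nat.le_mul_of_pos_right _ this
  refine (Finset.sum_le_sum h1).trans (le_of_eq ?_)
  rw [add_pow]
  have : Finset.Iic v = Finset.range (v + 1) := by ext; simp
  rw [this]
  simp

/-- The Sauer-Shelah bound on the number of traces, also for families with repeated points. -/
lemma card_traces_le {d : ℕ} {ι : Type*} [Fintype ι]
    {𝒜 : Set (Set (EuclideanSpace ℝ (Fin d)))} {v : ℕ} (hv : vcDim 𝒜 = v)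
    (z : ι → EuclideanSpace ℝ (Fin d)) :
    (traces 𝒜 z).card ≤ (Fintype.card ι + 1) ^ v := by
  classical
  have hdim : (traces 𝒜 z).vcDim ≤ v :=
    Finset.sup_le fun s hs => card_le_of_shatters hv z (Finset.mem_shatterer.1 hs)
  calc (traces 𝒜 z).card ≤ (traces 𝒜 z).shatterer.card := Finset.card_le_card_shatterer _
    _ ≤ ∑ k ∈ Finset.Iic (traces 𝒜 z).vcDim, (Fintype.card ι).choose k :=
      Finset.card_shatterer_le_sum_vcDim
    _ ≤ ∑ k ∈ Finset.Iic v, (Fintype.card ι).choose k :=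
      Finset.sum_le_sum_of_subset (Finset.Iic_subset_Iic.2 hdim)
    _ ≤ _ := sum_choose_le_succ_pow _ _

/-! ### Measurability of trace events -/

/-- Weights that single out the index set `t`: `1` on `t` and a small negative value off `t`.
Among all `s`, the absolute value of the weight of `s` reaches `t.card` only at `s = t`. -/
noncomputable def exposingWeight {m : ℕ} (t : Finset (Fin m)) (i : Fin m) : ℝ :=
  if i ∈ t then 1 else -(1 / (2 * m))

lemma sum_exposingWeight {m : ℕ} (s t : Finset (Fin m)) : ∑ i ∈ s, exposingWeight t i =
    (s.filter (· ∈ t)).card - (s.filter (· ∉ t)).card * (1 / (2 * m) : ℝ) := by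
  simp only [exposingWeight, Finset.sum_ite, Finset.sum_const, nsmul_eq_mul]
  ring

lemma abs_sum_exposingWeight_le {m : ℕ} {t : Finset (Fin m)} (ht : t.Nonempty)
    (s : Finset (Fin m)) : |∑ i ∈ s, exposingWeight t i| ≤ t.card := by
  have hm : 0 < m := Fin.pos (Classical.choose ht)
  have h1 : ((s.filter (· ∈ t)).card : ℝ) ≤ t.card := by
    exact_mod_cast Finset.card_le_card fun i hi => (Finset.mem_filter.1 hi).2
  have h2 : ((s.filter (· ∉ t)).card : ℝ) ≤ m := by
    exact_mod_cast (Finset.card_le_univ _).trans (by simp)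
  have h3 : ((s.filter (· ∉ t)).card : ℝ) * (1 / (2 * m)) ≤ 1 := by
    have : (0 : ℝ) < m := by exact_mod_cast hm
    rw [mul_one_div, div_le_one (by positivity)]
    linarith
  have h4 : (1 : ℝ) ≤ t.card := by exact_mod_cast ht.card_pos
  have h5 : (0 : ℝ) ≤ ((s.filter (· ∉ t)).card : ℝ) * (1 / (2 * m)) := by positivity
  have h6 : (0 : ℝ) ≤ (s.filter (· ∈ t)).card := by positivity
  rw [sum_exposingWeight, abs_le]
  constructor <;> linarith

lemma eq_of_abs_sum_exposingWeight {m : ℕ} {s t : Finset (Fin m)} (ht : t.Nonempty)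
    (h : |∑ i ∈ s, exposingWeight t i| = t.card) : s = t := by
  have hm : 0 < m := Fin.pos (Classical.choose ht)
  have hm' : (0 : ℝ) < m := by exact_mod_cast hm
  have h1 : (s.filter (· ∈ t)).card ≤ t.card :=
    Finset.card_le_card fun i hi => (Finset.mem_filter.1 hi).2
  have h1' : ((s.filter (· ∈ t)).card : ℝ) ≤ t.card := by exact_mod_cast h1
  have h2 : ((s.filter (· ∉ t)).card : ℝ) ≤ m := by
    exact_mod_cast (Finset.card_le_univ _).trans (by simp)
  have h3 : ((s.filter (· ∉ t)).card : ℝ) * (1 / (2 * m)) ≤ 1 / 2 := by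
    rw [mul_one_div, div_le_div_iff₀ (by positivity) (by norm_num)]
    linarith
  have h4 : (1 : ℝ) ≤ t.card := by exact_mod_cast ht.card_pos
  have h5 : (0 : ℝ) ≤ ((s.filter (· ∉ t)).card : ℝ) * (1 / (2 * m)) := by positivity
  have h6 : (0 : ℝ) ≤ (s.filter (· ∈ t)).card := by positivity
  rw [sum_exposingWeight] at h
  have h7 : ((s.filter (· ∈ t)).card : ℝ) - (s.filter (· ∉ t)).card * (1 / (2 * m)) = t.card := by
    rcases abs_choice (((s.filter (· ∈ t)).card : ℝ) - (s.filter (· ∉ t)).card * (1 / (2 * m)))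
      with h' | h' <;> rw [h'] at h <;> linarith
  have h8 : ((s.filter (· ∉ t)).card : ℝ) * (1 / (2 * m)) = 0 := by linarith
  have h9 : (s.filter (· ∉ t)).card = 0 := by
    have : (1 / (2 * m) : ℝ) ≠ 0 := by positivity
    exact_mod_cast (mul_eq_zero.1 h8).resolve_right this
  have h10 : s ⊆ t := by
    intro i hi
    by_contra hit
    rw [Finset.card_eq_zero] at h9
    exact Finset.notMem_empty i (h9 ▸ Finset.mem_filter.2 ⟨hi, hit⟩)
  refine Finset.eq_of_subset_of_card_le h10 ?_
  have : ((s.filter (· ∈ t)).card : ℝ) = t.card := by linarith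
  have h11 : (s.filter (· ∈ t)).card = t.card := by exact_mod_cast this
  rw [← h11]
  exact Finset.card_le_card (Finset.filter_subset _ _)

/-- A nonempty `t` is a trace exactly when the supremum over the class of the absolute weighted
sum with weights exposing `t` reaches `t.card`. This turns the measurability of suprema of absolute
values into measurability of each single trace event. -/
lemma mem_traces_iff_iSup_eq {d m : ℕ} {𝒜 : Set (Set (EuclideanSpace ℝ (Fin d)))}
    {t : Finset (Fin m)} (ht : t.Nonempty) (z : Fin m → EuclideanSpace ℝ (Fin d)) :
    t ∈ traces 𝒜 z ↔ (⨆ A : 𝒜, |∑ i, exposingWeight t i *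
      (A : Set (EuclideanSpace ℝ (Fin d))).indicator (fun _ => (1 : ℝ)) (z i)|) = t.card := by
  classical
  have hval : ∀ A : Set (EuclideanSpace ℝ (Fin d)),
      ∑ i, exposingWeight t i * A.indicator (fun _ => (1 : ℝ)) (z i) =
        ∑ i ∈ Finset.univ.filter (fun i => z i ∈ A), exposingWeight t i := by
    intro A
    simp [Set.indicator_apply, Finset.sum_filter]
  simp only [hval]
  have hcard : (0 : ℝ) < t.card := by exact_mod_cast ht.card_pos
  have hle : ∀ A : 𝒜, |∑ i ∈ Finset.univ.filter (fun i => z i ∈ (A : Set _)),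
      exposingWeight t i| ≤ t.card := fun A => abs_sum_exposingWeight_le ht _
  constructor
  · rw [mem_traces]
    rintro ⟨A, hA, hAt⟩
    have htA : Finset.univ.filter (fun i => z i ∈ A) = t := by
      ext i
      simp [hAt]
    have hsum : |∑ i ∈ t, exposingWeight t i| = t.card := by
      rw [sum_exposingWeight, Finset.filter_true_of_mem fun _ hi => hi,
        Finset.filter_false_of_mem fun _ hi => not_not.2 hi]
      simp
    have : Nonempty 𝒜 := ⟨⟨A, hA⟩⟩
    refine le_antisymm (ciSup_le hle) ?_
    refine le_ciSup_of_le ⟨(t.card : ℝ), Set.forall_mem_range.2 hle⟩ ⟨A, hA⟩ ?_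
    rw [htA, hsum]
  · intro h
    -- over an empty class the supremum is `0`, which is not `t.card`
    have hne : Nonempty 𝒜 := by
      by_contra hne
      rw [not_nonempty_iff] at hne
      rw [Real.iSup_of_isEmpty] at h
      exact hcard.ne h
    have hfin : (Set.range fun A : 𝒜 => |∑ i ∈ Finset.univ.filter (fun i => z i ∈ (A : Set _)),
        exposingWeight t i|).Finite := by
      refine Set.Finite.subset (Set.finite_range
        fun s : Finset (Fin m) => |∑ i ∈ s, exposingWeight t i|) ?_
      rintro _ ⟨A, rfl⟩
      exact ⟨_, rfl⟩
    -- finitely many traces, so the supremum is attained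
    obtain ⟨A, hA⟩ := (Set.range_nonempty _).csSup_mem hfin
    rw [iSup, ← hA] at h
    refine mem_traces.2 ⟨A, A.2, fun i => ?_⟩
    rw [← eq_of_abs_sum_exposingWeight ht h]
    simp

/-- Under the measurability condition on the class, "`t` is a trace" is an event up to null sets,
for every nonempty `t`. -/
lemma nullMeasurableSet_mem_traces {d : ℕ} {ι : Type*} [Fintype ι]
    {Q : Measure (EuclideanSpace ℝ (Fin d))} [IsProbabilityMeasure Q]
    {𝒜 : Set (Set (EuclideanSpace ℝ (Fin d)))} (h𝒜 : IsMeasurableClass Q 𝒜)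
    {t : Finset ι} (ht : t.Nonempty) :
    NullMeasurableSet {z : ι → EuclideanSpace ℝ (Fin d) | t ∈ traces 𝒜 z}
      (Measure.pi fun _ => Q) := by
  have hfin : ∀ (m : ℕ) (s : Finset (Fin m)), s.Nonempty → NullMeasurableSet
      {z : Fin m → EuclideanSpace ℝ (Fin d) | s ∈ traces 𝒜 z} (Measure.pi fun _ => Q) := by
    intro m s hs
    simp only [mem_traces_iff_iSup_eq hs]
    exact (h𝒜.2 m _).nullMeasurableSet_preimage (measurableSet_singleton (s.card : ℝ))
  let e : Fin (Fintype.card ι) ≃ ι := (Fintype.equivFin ι).symm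
  have hmp : MeasurePreserving (fun z : ι → EuclideanSpace ℝ (Fin d) => z ∘ e)
      (Measure.pi fun _ => Q) (Measure.pi fun _ => Q) :=
    (measurePreserving_arrowCongr' (μ := fun _ => Q) (ν := fun _ => Q) e.symm
      (MeasurableEquiv.refl _) fun _ => MeasurePreserving.id _)
  have := (hfin _ (t.map e.symm.toEmbedding) (by simpa using ht)).preimage
    hmp.quasiMeasurePreserving
  simpa only [Set.preimage_ofPred_eq, mem_traces_comp_equiv] using this

/-! ### Densities and domination for finite product measures -/

lemma lintegral_pi_prod_eq_prod {ι : Type*} [Fintype ι] {α : Type*} [MeasurableSpace α]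
    (μ : Measure α) [IsProbabilityMeasure μ] (f : ι → α → ℝ≥0∞) (hf : ∀ i, Measurable (f i)) :
    ∫⁻ p : ι → α, ∏ i, f i (p i) ∂(Measure.pi fun _ => μ) = ∏ i, ∫⁻ x, f i x ∂μ := by
  have hind : iIndepFun (fun i (p : ι → α) => f i (p i)) (Measure.pi fun _ => μ) :=
    iIndepFun_pi (μ := fun _ : ι => μ) (X := f) fun i => (hf i).aemeasurable
  have := lintegral_prod_eq_prod_lintegral_of_indepFun (μ := Measure.pi fun _ : ι => μ)
    Finset.univ (fun i (p : ι → α) => f i (p i)) hind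
    fun i => (hf i).comp (measurable_pi_apply i)
  rw [this]
  refine Finset.prod_congr rfl fun i _ => ?_
  exact (measurePreserving_eval (fun _ : ι => μ) i).lintegral_comp (hf i)

lemma pi_withDensity {ι : Type*} [Fintype ι] {α : Type*} [MeasurableSpace α]
    (μ : Measure α) [IsProbabilityMeasure μ] (f : ι → α → ℝ≥0∞) (hf : ∀ i, Measurable (f i))
    [∀ i, SigmaFinite (μ.withDensity (f i))] :
    (Measure.pi fun _ => μ).withDensity (fun p : ι → α => ∏ i, f i (p i)) =
      Measure.pi fun i => μ.withDensity (f i) := by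
  symm
  refine Measure.pi_eq fun s hs => ?_
  rw [withDensity_apply _ (MeasurableSet.univ_pi hs),
    ← lintegral_indicator (MeasurableSet.univ_pi hs)]
  simp_rw [withDensity_apply _ (hs _), ← lintegral_indicator (hs _)]
  rw [← lintegral_pi_prod_eq_prod μ _ fun i => (hf i).indicator (hs i)]
  refine lintegral_congr fun p => ?_
  by_cases hp : p ∈ Set.univ.pi s
  · rw [Set.indicator_of_mem hp]
    exact Finset.prod_congr rfl fun i _ => (Set.indicator_of_mem (hp i trivial) _).symm
  · rw [Set.indicator_of_notMem hp]
    obtain ⟨i, hi⟩ : ∃ i, p i ∉ s i := by simpa using hp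
    exact (Finset.prod_eq_zero (Finset.mem_univ i) (Set.indicator_of_notMem hi _)).symm

lemma pi_le_pi {ι : Type*} [Fintype ι] {α : Type*} [MeasurableSpace α]
    {μ ν : ι → Measure α} (h : ∀ i, μ i ≤ ν i) : Measure.pi μ ≤ Measure.pi ν := by
  refine Measure.le_iff.2 fun s hs => ?_
  rw [Measure.pi_def, Measure.pi_def, toMeasure_apply _ _ hs, toMeasure_apply _ _ hs]
  refine (OuterMeasure.le_pi.2 fun t _ => ?_) s
  exact (OuterMeasure.pi_pi_le _ _).trans (Finset.prod_le_prod' fun i _ => h i (t i))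

lemma pi_smul {ι : Type*} [Fintype ι] {α : Type*} [MeasurableSpace α]
    (μ : Measure α) [IsProbabilityMeasure μ] (c : ι → ℝ≥0) :
    Measure.pi (fun i => c i • μ) = (∏ i, c i) • Measure.pi fun _ : ι => μ := by
  refine Measure.pi_eq fun s _ => ?_
  simp only [Measure.smul_apply, Measure.pi_pi, ENNReal.smul_def, smul_eq_mul,
    Finset.prod_mul_distrib, ENNReal.ofNNReal_finsetProd]

/-! ### Sub-Gaussian tails conditionally on the covariates -/

/-- The conditional bound on the moment generating function of the noise, as a domination of
measures on the space of covariates. The noise is replaced by a Borel modification `ε`. -/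
def MGFDominated {α : Type*} [MeasurableSpace α] (P : Measure (α × ℝ)) (ε : α × ℝ → ℝ)
    (σ : ℝ) : Prop :=
  ∀ t : ℝ, (P.withDensity fun p => ENNReal.ofReal (Real.exp (t * ε p))).map Prod.fst ≤
    (Real.exp (t ^ 2 * σ ^ 2 / 2)).toNNReal • P.map Prod.fst

/-- Chernoff's bound for a weighted sum of the noise variables, on an event that depends on the
covariates only. -/
lemma measure_lt_weighted_noise_le {ι α : Type*} [Fintype ι] [MeasurableSpace α]
    {P : Measure (α × ℝ)} [IsProbabilityMeasure P] {ε : α × ℝ → ℝ} (hε : Measurable ε) {σ : ℝ}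
    (hσ : MGFDominated P ε σ) {E : Set (ι → α)} (hE : MeasurableSet E) (l : ι → ℝ) (u : ℝ) :
    (Measure.pi fun _ => P) {p : ι → α × ℝ | (fun i => (p i).1) ∈ E ∧ u < ∑ i, l i * ε (p i)} ≤
      ENNReal.ofReal (Real.exp (-u + ∑ i, l i ^ 2 * σ ^ 2 / 2)) *
        (Measure.pi fun _ => P.map Prod.fst) E := by
  let f : ι → α × ℝ → ℝ≥0∞ := fun i p => ENNReal.ofReal (Real.exp (l i * ε p))
  have hf : ∀ i, Measurable (f i) := fun i => by fun_prop
  let c : ι → ℝ≥0 := fun i => (Real.exp (l i ^ 2 * σ ^ 2 / 2)).toNNReal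
  have hfst : Measurable fun (p : ι → α × ℝ) i => (p i).1 := by fun_prop
  have : IsProbabilityMeasure (P.map Prod.fst) :=
    Measure.isProbabilityMeasure_map measurable_fst.aemeasurable
  have hfin : ∀ i, IsFiniteMeasure (P.withDensity (f i)) := by
    intro i
    refine ⟨?_⟩
    have h := hσ (l i) Set.univ
    rw [Measure.map_apply measurable_fst MeasurableSet.univ, Set.preimage_univ] at h
    exact h.trans_lt (measure_lt_top _ _)
  set F : Set (ι → α × ℝ) := {p | (fun i => (p i).1) ∈ E ∧ u < ∑ i, l i * ε (p i)} with hF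
  have hFE : F ⊆ (fun (p : ι → α × ℝ) i => (p i).1) ⁻¹' E := fun p hp => hp.1
  have hFm : MeasurableSet F :=
    (hfst hE).inter (measurableSet_lt measurable_const
      (Finset.measurable_sum _ fun i _ => (hε.comp (measurable_pi_apply i)).const_mul _))
  calc (Measure.pi fun _ => P) F
      = ∫⁻ _ in F, 1 ∂(Measure.pi fun _ => P) := by simp
    _ ≤ ∫⁻ p in F, ENNReal.ofReal (Real.exp (-u)) * ∏ i, f i (p i) ∂(Measure.pi fun _ => P) := by
        refine setLIntegral_mono (by fun_prop) fun p hp => ?_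
        rw [← ENNReal.ofReal_prod_of_nonneg fun _ _ => (Real.exp_pos _).le,
          ← ENNReal.ofReal_mul (Real.exp_pos _).le, ← Real.exp_sum, ← Real.exp_add,
          ← ENNReal.ofReal_one]
        refine ENNReal.ofReal_le_ofReal (Real.one_le_exp ?_)
        have := hp.2
        linarith
    _ = ENNReal.ofReal (Real.exp (-u)) * Measure.pi (fun i => P.withDensity (f i)) F := by
        rw [lintegral_const_mul _ (by fun_prop), ← pi_withDensity P f hf,
          withDensity_apply _ hFm]
    _ ≤ ENNReal.ofReal (Real.exp (-u)) * Measure.pi (fun i => P.withDensity (f i))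
          ((fun (p : ι → α × ℝ) i => (p i).1) ⁻¹' E) := by gcongr
    _ = ENNReal.ofReal (Real.exp (-u)) *
          Measure.pi (fun i => (P.withDensity (f i)).map Prod.fst) E := by
        rw [← Measure.pi_map_pi fun i => measurable_fst.aemeasurable, Measure.map_apply hfst hE]
    _ ≤ ENNReal.ofReal (Real.exp (-u)) *
          Measure.pi (fun i => c i • P.map Prod.fst) E := by
        gcongr
        exact pi_le_pi fun i => hσ (l i)
    _ = _ := by
        rw [pi_smul, Measure.smul_apply, ENNReal.smul_def, smul_eq_mul, ← mul_assoc,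
          ENNReal.ofNNReal_finsetProd, Real.exp_add, ENNReal.ofReal_mul (Real.exp_pos _).le,
          Real.exp_sum, ENNReal.ofReal_prod_of_nonneg fun _ _ => (Real.exp_pos _).le]
        rfl

/-- One-sided tail of the noise over an index set `t`, on an event `E` that depends on the
covariates only; `s = ±1` selects the side. The threshold is `0` when `σ = 0` or `t = ∅`; then the
noise sum vanishes almost surely. -/
lemma measure_signed_noise_sum_le {ι α : Type*} [Fintype ι] [MeasurableSpace α]
    {P : Measure (α × ℝ)} [IsProbabilityMeasure P] {ε : α × ℝ → ℝ} (hε : Measurable ε) {σ : ℝ}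
    (hσ : MGFDominated P ε σ) {E : Set (ι → α)} (hE : MeasurableSet E) (t : Finset ι)
    {Λ : ℝ} (hΛ : 0 ≤ Λ) {s : ℝ} (hs : s ^ 2 = 1) :
    (Measure.pi fun _ => P) {p : ι → α × ℝ | (fun i => (p i).1) ∈ E ∧
        √(2 * σ ^ 2 * t.card * Λ) < s * ∑ i ∈ t, ε (p i)} ≤
      ENNReal.ofReal (Real.exp (-Λ)) * (Measure.pi fun _ => P.map Prod.fst) E := by
  classical
  have hfstp : IsProbabilityMeasure (P.map Prod.fst) :=
    Measure.isProbabilityMeasure_map measurable_fst.aemeasurable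
  have key : ∀ l u : ℝ, (Measure.pi fun _ => P) {p : ι → α × ℝ | (fun i => (p i).1) ∈ E ∧
        u < l * (s * ∑ i ∈ t, ε (p i))} ≤
      ENNReal.ofReal (Real.exp (-u + l ^ 2 * (σ ^ 2 * t.card) / 2)) *
        (Measure.pi fun _ => P.map Prod.fst) E := by
    intro l u
    convert measure_lt_weighted_noise_le hε hσ hE (fun i => if i ∈ t then l * s else 0) u using 8
    · simp [← mul_assoc, Finset.mul_sum]
    · have : ∀ i, (if i ∈ t then l * s else 0) ^ 2 * σ ^ 2 / 2 =
          if i ∈ t then l ^ 2 * σ ^ 2 / 2 else 0 := by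
        intro i
        split_ifs
        · rw [mul_pow, hs, mul_one]
        · simp
      simp only [this]
      simp only [Finset.sum_ite_mem, Finset.univ_inter, Finset.sum_const, nsmul_eq_mul]
      ring
  have hV0 : 0 ≤ σ ^ 2 * t.card := by positivity
  rcases hV0.eq_or_lt with hV | hV
  -- degenerate case: Chernoff's bound with arbitrarily large parameters shows that the event is null
  · have hthr : √(2 * σ ^ 2 * t.card * Λ) = 0 := by
      rw [mul_assoc 2, ← hV]
      simp
    have hnull : ∀ k : ℕ, (Measure.pi fun _ => P) {p : ι → α × ℝ | (fun i => (p i).1) ∈ E ∧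
        1 < ((k : ℝ) + 1) * (s * ∑ i ∈ t, ε (p i))} = 0 := by
      intro k
      have hlim : Filter.Tendsto (fun M : ℕ => ENNReal.ofReal (Real.exp (-(M : ℝ))))
          Filter.atTop (nhds 0) := by
        rw [← ENNReal.ofReal_zero]
        exact ENNReal.tendsto_ofReal
          (Real.tendsto_exp_neg_atTop_nhds_zero.comp tendsto_natCast_atTop_atTop)
      refine le_antisymm (ge_of_tendsto hlim ?_) zero_le
      filter_upwards [Filter.eventually_gt_atTop 0] with M hM
      have hM' : (0 : ℝ) < M := by exact_mod_cast hM
      calc _ ≤ (Measure.pi fun _ => P) {p : ι → α × ℝ | (fun i => (p i).1) ∈ E ∧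
            (M : ℝ) < (M * (k + 1)) * (s * ∑ i ∈ t, ε (p i))} := by
            refine measure_mono fun p hp => ⟨hp.1, ?_⟩
            have := mul_lt_mul_of_pos_left hp.2 hM'
            rw [mul_one] at this
            rwa [mul_assoc]
        _ ≤ _ := key _ _
        _ ≤ ENNReal.ofReal (Real.exp (-(M : ℝ))) * 1 := by
            rw [← hV]
            gcongr
            · simp
            · exact prob_le_one
        _ = _ := mul_one _
    refine le_trans (le_of_eq (measure_mono_null ?_ (measure_iUnion_null hnull))) zero_le
    rintro p ⟨hpE, hp⟩
    rw [hthr] at hp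
    obtain ⟨k, hk⟩ := exists_nat_one_div_lt hp
    refine Set.mem_iUnion.2 ⟨k, hpE, ?_⟩
    rwa [div_lt_iff₀' (by positivity)] at hk
  · set V := σ ^ 2 * t.card with hVdef
    have hthr : 2 * σ ^ 2 * t.card * Λ = 2 * V * Λ := by rw [hVdef]; ring
    rw [hthr]
    rcases hΛ.eq_or_lt with h0 | h0
    · rw [← h0]
      simp only [neg_zero, Real.exp_zero, ENNReal.ofReal_one, one_mul]
      have hfst : Measurable fun (p : ι → α × ℝ) i => (p i).1 := by fun_prop
      rw [← Measure.pi_map_pi fun i => measurable_fst.aemeasurable, Measure.map_apply hfst hE]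
      exact measure_mono fun p hp => hp.1
    · have hu : 0 < √(2 * V * Λ) := Real.sqrt_pos.2 (by positivity)
      have hu2 : √(2 * V * Λ) ^ 2 = 2 * V * Λ := Real.sq_sqrt (by positivity)
      -- the Chernoff parameter `√(2 V Λ) / V` is the optimal one for variance proxy `V`
      have hsub : {p : ι → α × ℝ | (fun i => (p i).1) ∈ E ∧
          √(2 * V * Λ) < s * ∑ i ∈ t, ε (p i)} ⊆ {p : ι → α × ℝ | (fun i => (p i).1) ∈ E ∧
          2 * Λ < √(2 * V * Λ) / V * (s * ∑ i ∈ t, ε (p i))} := by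
        rintro p ⟨hpE, hp⟩
        refine ⟨hpE, ?_⟩
        have := mul_lt_mul_of_pos_left hp (div_pos hu hV)
        refine lt_of_eq_of_lt ?_ this
        rw [div_mul_eq_mul_div, ← sq, hu2]
        field_simp
      refine (measure_mono hsub).trans ((key _ _).trans (le_of_eq ?_))
      congr 3
      rw [div_pow, hu2]
      field_simp
      ring

/-- The sum of the probabilities that `t` is a trace is the expected number of nonempty traces. -/
lemma sum_measure_mem_traces_le {d : ℕ} {ι : Type*} [Fintype ι]
    {Q : Measure (EuclideanSpace ℝ (Fin d))} [IsProbabilityMeasure Q]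
    {𝒜 : Set (Set (EuclideanSpace ℝ (Fin d)))} (h𝒜 : IsMeasurableClass Q 𝒜) {v : ℕ}
    (hv : vcDim 𝒜 = v) (T : Finset (Finset ι)) (hT : ∀ t ∈ T, t.Nonempty) :
    ∑ t ∈ T, (Measure.pi fun _ => Q) {z : ι → EuclideanSpace ℝ (Fin d) | t ∈ traces 𝒜 z} ≤
      ((Fintype.card ι + 1) ^ v : ℕ) := by
  classical
  calc _ = ∑ t ∈ T, ∫⁻ z, {z : ι → EuclideanSpace ℝ (Fin d) | t ∈ traces 𝒜 z}.indicator 1 z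
        ∂(Measure.pi fun _ => Q) :=
        Finset.sum_congr rfl fun t ht =>
          (lintegral_indicator_one₀ (nullMeasurableSet_mem_traces h𝒜 (hT t ht))).symm
    _ = ∫⁻ z, ∑ t ∈ T, {z : ι → EuclideanSpace ℝ (Fin d) | t ∈ traces 𝒜 z}.indicator 1 z
        ∂(Measure.pi fun _ => Q) :=
        (lintegral_finsetSum' _ fun t ht => (aemeasurable_indicator_const_iff 1).2
          (nullMeasurableSet_mem_traces h𝒜 (hT t ht))).symm
    _ ≤ ∫⁻ _, ((Fintype.card ι + 1) ^ v : ℕ) ∂(Measure.pi fun _ : ι => Q) := by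
        refine lintegral_mono fun z => ?_
        simp only [Set.indicator_apply, Set.mem_ofPred_eq, Pi.one_apply, Finset.sum_boole]
        have : (T.filter fun t => t ∈ traces 𝒜 z).card ≤ (traces 𝒜 z).card :=
          Finset.card_le_card fun t ht => (Finset.mem_filter.1 ht).2
        exact_mod_cast this.trans (card_traces_le hv z)
    _ = _ := by simp

/-- Uniform control of the noise over all traces: the union bound is taken conditionally on the
covariates, where only the realised traces count. -/
lemma measure_exists_trace_noise_le {d : ℕ} {ι : Type*} [Fintype ι]
    {P : Measure (EuclideanSpace ℝ (Fin d) × ℝ)} [IsProbabilityMeasure P]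
    {ε : EuclideanSpace ℝ (Fin d) × ℝ → ℝ} (hε : Measurable ε) {σ : ℝ}
    (hσ : MGFDominated P ε σ) {𝒜 : Set (Set (EuclideanSpace ℝ (Fin d)))}
    (h𝒜 : IsMeasurableClass (P.map Prod.fst) 𝒜) {v : ℕ} (hv : vcDim 𝒜 = v)
    {Λ : ℝ} (hΛ : 0 ≤ Λ) :
    (Measure.pi fun _ => P) {p : ι → EuclideanSpace ℝ (Fin d) × ℝ |
        ∃ t ∈ traces 𝒜 (fun i => (p i).1), √(2 * σ ^ 2 * t.card * Λ) < |∑ i ∈ t, ε (p i)|} ≤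
      2 * ENNReal.ofReal (Real.exp (-Λ)) * ((Fintype.card ι + 1) ^ v : ℕ) := by
  classical
  have hfstp : IsProbabilityMeasure (P.map Prod.fst) :=
    Measure.isProbabilityMeasure_map measurable_fst.aemeasurable
  let T : Finset (Finset ι) := {t | t.Nonempty}
  let H : Finset ι → Set (ι → EuclideanSpace ℝ (Fin d)) := fun t =>
    toMeasurable (Measure.pi fun _ => P.map Prod.fst) {z | t ∈ traces 𝒜 z}
  let D : ℝ → Finset ι → Set (ι → EuclideanSpace ℝ (Fin d) × ℝ) := fun s t =>
    {p | (fun i => (p i).1) ∈ H t ∧ √(2 * σ ^ 2 * t.card * Λ) < s * ∑ i ∈ t, ε (p i)}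
  have hsub : {p : ι → EuclideanSpace ℝ (Fin d) × ℝ | ∃ t ∈ traces 𝒜 (fun i => (p i).1),
      √(2 * σ ^ 2 * t.card * Λ) < |∑ i ∈ t, ε (p i)|} ⊆ ⋃ t ∈ T, (D 1 t ∪ D (-1) t) := by
    rintro p ⟨t, ht, hp⟩
    -- the empty trace carries no noise; its event need not be measurable
    have hne : t.Nonempty := by
      rw [Finset.nonempty_iff_ne_empty]
      rintro rfl
      simp at hp
    have hH : (fun i => (p i).1) ∈ H t := subset_toMeasurable _ _ ht
    refine Set.mem_biUnion (Finset.mem_filter.2 ⟨Finset.mem_univ t, hne⟩) ?_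
    rcases lt_abs.1 hp with h | h
    · exact Or.inl ⟨hH, by rwa [one_mul]⟩
    · exact Or.inr ⟨hH, by rwa [neg_one_mul]⟩
  calc _ ≤ (Measure.pi fun _ => P) (⋃ t ∈ T, (D 1 t ∪ D (-1) t)) := measure_mono hsub
    _ ≤ ∑ t ∈ T, (Measure.pi fun _ => P) (D 1 t ∪ D (-1) t) := measure_biUnion_finset_le _ _
    _ ≤ ∑ t ∈ T, 2 * ENNReal.ofReal (Real.exp (-Λ)) * (Measure.pi fun _ => P.map Prod.fst)
          {z : ι → EuclideanSpace ℝ (Fin d) | t ∈ traces 𝒜 z} := by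
        refine Finset.sum_le_sum fun t _ => (measure_union_le _ _).trans ?_
        have h1 := measure_signed_noise_sum_le hε hσ (measurableSet_toMeasurable
          (Measure.pi fun _ => P.map Prod.fst) {z | t ∈ traces 𝒜 z}) t hΛ (s := 1) (by norm_num)
        have h2 := measure_signed_noise_sum_le hε hσ (measurableSet_toMeasurable
          (Measure.pi fun _ => P.map Prod.fst) {z | t ∈ traces 𝒜 z}) t hΛ (s := -1) (by norm_num)
        rw [measure_toMeasurable] at h1 h2
        rw [mul_assoc, two_mul]
        exact add_le_add h1 h2
    _ ≤ _ := by
        rw [← Finset.mul_sum]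
        gcongr
        exact sum_measure_mem_traces_le h𝒜 hv T fun t ht => (Finset.mem_filter.1 ht).2

/-- The conditional sub-Gaussian property passes to a Borel modification of the noise, in the form
of a domination of measures. -/
lemma CondSubGaussianNoise.exists_mgfDominated {d : ℕ}
    {P : Measure (EuclideanSpace ℝ (Fin d) × ℝ)} [IsProbabilityMeasure P]
    {g : EuclideanSpace ℝ (Fin d) → ℝ} {σ : ℝ} (h : CondSubGaussianNoise P g σ) :
    ∃ ε : EuclideanSpace ℝ (Fin d) × ℝ → ℝ, Measurable ε ∧ (∀ᵐ p ∂P, p.2 - g p.1 = ε p) ∧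
      MGFDominated P ε σ := by
  obtain ⟨hint, -, hexp⟩ := h
  refine ⟨hint.1.mk _, hint.1.stronglyMeasurable_mk.measurable, hint.1.ae_eq_mk, fun t => ?_⟩
  have hm : MeasurableSpace.comap (Prod.fst : EuclideanSpace ℝ (Fin d) × ℝ → _) inferInstance ≤
      (inferInstance : MeasurableSpace (EuclideanSpace ℝ (Fin d) × ℝ)) :=
    measurable_fst.comap_le
  obtain ⟨hi, hc⟩ := hexp t
  refine Measure.le_iff.2 fun A hA => ?_
  have hA' : MeasurableSet (Prod.fst ⁻¹' A : Set (EuclideanSpace ℝ (Fin d) × ℝ)) :=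
    measurable_fst hA
  have hA'' : MeasurableSet[MeasurableSpace.comap Prod.fst inferInstance]
      (Prod.fst ⁻¹' A : Set (EuclideanSpace ℝ (Fin d) × ℝ)) := ⟨A, hA, rfl⟩
  rw [Measure.map_apply measurable_fst hA, withDensity_apply _ hA', Measure.smul_apply,
    Measure.map_apply measurable_fst hA, ENNReal.smul_def, smul_eq_mul]
  calc ∫⁻ p in Prod.fst ⁻¹' A, ENNReal.ofReal (Real.exp (t * hint.1.mk _ p)) ∂P
      = ∫⁻ p in Prod.fst ⁻¹' A, ENNReal.ofReal (Real.exp (t * (p.2 - g p.1))) ∂P := by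
        refine lintegral_congr_ae (ae_restrict_of_ae ?_)
        filter_upwards [hint.1.ae_eq_mk] with p hp
        rw [hp]
    _ = ENNReal.ofReal (∫ p in Prod.fst ⁻¹' A, Real.exp (t * (p.2 - g p.1)) ∂P) :=
        (ofReal_integral_eq_lintegral_ofReal hi.integrableOn
          (Filter.Eventually.of_forall fun _ => (Real.exp_pos _).le)).symm
    _ ≤ ENNReal.ofReal (∫ _ in (Prod.fst ⁻¹' A : Set (EuclideanSpace ℝ (Fin d) × ℝ)),
          Real.exp (t ^ 2 * σ ^ 2 / 2) ∂P) := by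
        rw [← setIntegral_condExp hm hi hA'']
        refine ENNReal.ofReal_le_ofReal ?_
        exact setIntegral_mono_ae integrable_condExp.integrableOn
          (integrable_const _).integrableOn hc
    _ = _ := by
        rw [setIntegral_const, smul_eq_mul, mul_comm, ENNReal.ofReal_mul (Real.exp_pos _).le,
          ofReal_measureReal]
        rfl

/-! ### Relative deviations of the empirical measure -/

/-- A double sample indexed by `ι × Bool`, assembled from a sample (at `false`) and a ghost sample
(at `true`). -/
def doubleSample {ι α : Type*} (x : (ι → α) × (ι → α)) (p : ι × Bool) : α :=
  if p.2 then x.2 p.1 else x.1 p.1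

lemma measurePreserving_doubleSample {ι α : Type*} [Fintype ι] [MeasurableSpace α]
    (Q : Measure α) [IsProbabilityMeasure Q] :
    MeasurePreserving (doubleSample : (ι → α) × (ι → α) → ι × Bool → α)
      ((Measure.pi fun _ => Q).prod (Measure.pi fun _ => Q)) (Measure.pi fun _ => Q) := by
  have hm : Measurable (doubleSample : (ι → α) × (ι → α) → ι × Bool → α) := by
    refine measurable_pi_lambda _ fun p => ?_
    rcases p with ⟨i, b | b⟩ <;> simp only [doubleSample] <;> simp <;> fun_prop
  refine ⟨hm, (Measure.pi_eq fun s hs => ?_).symm⟩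
  rw [Measure.map_apply hm (MeasurableSet.univ_pi hs)]
  have : (doubleSample : (ι → α) × (ι → α) → ι × Bool → α) ⁻¹' Set.univ.pi s =
      (Set.univ.pi fun i => s (i, false)) ×ˢ (Set.univ.pi fun i => s (i, true)) := by
    ext x
    simp [doubleSample, forall_and]
  rw [this, Measure.prod_prod, Measure.pi_pi, Measure.pi_pi, Fintype.prod_prod_type]
  simp [Finset.prod_mul_distrib, mul_comm]

/-- The permutation of the double sample that exchanges the `i`-th point with its ghost whenever
`s i` is true. -/
def swapEquiv {ι : Type*} (s : ι → Bool) : ι × Bool ≃ ι × Bool :=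
  Function.Involutive.toPerm (fun p => (p.1, xor p.2 (s p.1))) fun p => by simp

lemma mem_map_swapEquiv_symm {ι : Type*} (s : ι → Bool) (t : Finset (ι × Bool)) (i : ι)
    (b : Bool) : (i, b) ∈ t.map (swapEquiv s).symm.toEmbedding ↔ (i, xor b (s i)) ∈ t := by
  rw [Finset.mem_map_equiv]
  rfl

open Classical in
/-- The exponential weight of a trace on the double sample: each ghost point in the trace counts
`1 / 2` and each point of the first sample `-3 / 2`. A pair with one point in the trace has average
weight at most `1` under exchange of the two points, and a pair with both points in the trace has
weight less than `1`. -/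
noncomputable def swapWeight {ι : Type*} [Fintype ι] (t : Finset (ι × Bool)) : ℝ :=
  ∏ i, Real.exp (((if (i, true) ∈ t then 1 else 0) - 3 * (if (i, false) ∈ t then 1 else 0)) / 2)

lemma sum_swapWeight_le {ι : Type*} [Fintype ι] [DecidableEq ι] (t : Finset (ι × Bool)) :
    ∑ s : ι → Bool, swapWeight (t.map (swapEquiv s).symm.toEmbedding) ≤
      2 ^ Fintype.card ι := by
  classical
  let ψ : ι → Bool → ℝ := fun i b =>
    Real.exp (((if (i, xor true b) ∈ t then 1 else 0) -
      3 * (if (i, xor false b) ∈ t then 1 else 0)) / 2)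
  have h1 : ∀ s : ι → Bool, swapWeight (t.map (swapEquiv s).symm.toEmbedding) =
      ∏ i, ψ i (s i) := by
    intro s
    simp only [swapWeight, mem_map_swapEquiv_symm, ψ]
  have h2 : ∀ i, ∑ b, ψ i b ≤ 2 := by
    intro i
    have e1 : Real.exp (1 / 2) ≤ 7 / 4 := by
      have h := Real.exp_one_lt_d9
      have h' : Real.exp (1 / 2) ^ 2 = Real.exp 1 := by
        rw [← Real.exp_nat_mul]
        norm_num
      nlinarith [Real.exp_pos (1 / 2)]
    have e2 : Real.exp (-3 / 2) ≤ 1 / 4 := by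
      have h := Real.exp_one_gt_d9
      have h' : Real.exp (-3 / 2) ^ 2 * Real.exp 1 ^ 3 = 1 := by
        rw [← Real.exp_nat_mul, ← Real.exp_nat_mul, ← Real.exp_add]
        norm_num
      have h3 : (16 : ℝ) ≤ Real.exp 1 ^ 3 := by
        calc (16 : ℝ) ≤ 2.7 ^ 3 := by norm_num
          _ ≤ _ := by gcongr; linarith
      have h4 := Real.exp_pos (-3 / 2)
      by_contra hc
      push Not at hc
      have h5 : (1 / 4 : ℝ) ^ 2 < Real.exp (-3 / 2) ^ 2 := by gcongr
      nlinarith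
    have e3 : Real.exp (-1) ≤ 1 := Real.exp_le_one_iff.2 (by norm_num)
    simp only [Fintype.sum_bool, ψ, Bool.xor_false, Bool.xor_true, Bool.not_true, Bool.not_false]
    split_ifs <;> norm_num <;> norm_num at e1 e2 <;> linarith
  simp only [h1]
  calc ∑ s : ι → Bool, ∏ i, ψ i (s i) = ∏ i, ∑ b, ψ i b := by
        rw [Finset.prod_univ_sum, Fintype.piFinset_univ]
    _ ≤ ∏ _i : ι, (2 : ℝ) :=
        Finset.prod_le_prod (fun i _ => Finset.sum_nonneg fun b _ => (Real.exp_pos _).le)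
          fun i _ => h2 i
    _ = _ := by simp

/-- Exchangeability of the double sample: a permutation of the indices does not change the
probability that an index set is a trace. -/
lemma measure_mem_traces_map {d : ℕ} {ι : Type*} [Fintype ι]
    {Q : Measure (EuclideanSpace ℝ (Fin d))} [IsProbabilityMeasure Q]
    (𝒜 : Set (Set (EuclideanSpace ℝ (Fin d)))) (e : ι ≃ ι) (t : Finset ι) :
    (Measure.pi fun _ => Q) {z : ι → EuclideanSpace ℝ (Fin d) |
        t.map e.symm.toEmbedding ∈ traces 𝒜 z} =
      (Measure.pi fun _ => Q) {z : ι → EuclideanSpace ℝ (Fin d) | t ∈ traces 𝒜 z} := by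
  have hmp : MeasurePreserving (MeasurableEquiv.arrowCongr' e.symm
      (MeasurableEquiv.refl (EuclideanSpace ℝ (Fin d))))
      (Measure.pi fun _ => Q) (Measure.pi fun _ => Q) :=
    measurePreserving_arrowCongr' (μ := fun _ => Q) (ν := fun _ => Q) e.symm
      (MeasurableEquiv.refl _) fun _ => MeasurePreserving.id _
  rw [← hmp.measure_preimage_equiv]
  congr 1
  ext z
  exact mem_traces_comp_equiv e z t

/-- Averaging over all exchanges: the expected total weight of the traces on the double sample is
at most the bound on their number. -/
lemma sum_swapWeight_mul_measure_le {d : ℕ} {ι : Type*} [Fintype ι]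
    {Q : Measure (EuclideanSpace ℝ (Fin d))} [IsProbabilityMeasure Q]
    {𝒜 : Set (Set (EuclideanSpace ℝ (Fin d)))} (h𝒜 : IsMeasurableClass Q 𝒜) {v : ℕ}
    (hv : vcDim 𝒜 = v) :
    ∑ t : Finset (ι × Bool) with t.Nonempty, ENNReal.ofReal (swapWeight t) *
      (Measure.pi fun _ => Q) {z : ι × Bool → EuclideanSpace ℝ (Fin d) | t ∈ traces 𝒜 z} ≤
    ((2 * Fintype.card ι + 1) ^ v : ℕ) := by
  classical
  let T : Finset (Finset (ι × Bool)) := {t | t.Nonempty}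
  let m : Finset (ι × Bool) → ℝ≥0∞ := fun t =>
    (Measure.pi fun _ => Q) {z : ι × Bool → EuclideanSpace ℝ (Fin d) | t ∈ traces 𝒜 z}
  have hW : ∀ t : Finset (ι × Bool), 0 ≤ swapWeight t := fun t =>
    Finset.prod_nonneg fun i _ => (Real.exp_pos _).le
  have hswap : ∀ s : ι → Bool, ∑ t ∈ T, ENNReal.ofReal (swapWeight t) * m t =
      ∑ t ∈ T, ENNReal.ofReal (swapWeight (t.map (swapEquiv s).symm.toEmbedding)) * m t := by
    intro s
    symm
    refine Finset.sum_equiv (swapEquiv s).symm.finsetCongr (fun t => ?_) fun t _ => ?_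
    · simp [T]
    · simp only [m, Equiv.finsetCongr_apply]
      rw [measure_mem_traces_map 𝒜 (swapEquiv s) t]
  have hcard : (2 : ℝ≥0∞) ^ Fintype.card ι ≠ 0 := pow_ne_zero _ two_ne_zero
  have hcard' : (2 : ℝ≥0∞) ^ Fintype.card ι ≠ ∞ := ENNReal.pow_ne_top ENNReal.ofNat_ne_top
  -- both sides are multiplied by the number of exchanges
  refine (ENNReal.mul_le_mul_iff_right hcard hcard').1 ?_
  calc 2 ^ Fintype.card ι * ∑ t ∈ T, ENNReal.ofReal (swapWeight t) * m t
      = ∑ _s : ι → Bool, ∑ t ∈ T, ENNReal.ofReal (swapWeight t) * m t := by simp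
    _ = ∑ s : ι → Bool, ∑ t ∈ T,
          ENNReal.ofReal (swapWeight (t.map (swapEquiv s).symm.toEmbedding)) * m t :=
        Finset.sum_congr rfl fun s _ => hswap s
    _ = ∑ t ∈ T, ENNReal.ofReal (∑ s : ι → Bool,
          swapWeight (t.map (swapEquiv s).symm.toEmbedding)) * m t := by
        rw [Finset.sum_comm]
        refine Finset.sum_congr rfl fun t _ => ?_
        rw [ENNReal.ofReal_sum_of_nonneg fun _ _ => hW _, Finset.sum_mul]
    _ ≤ ∑ t ∈ T, 2 ^ Fintype.card ι * m t := by
        refine Finset.sum_le_sum fun t _ => ?_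
        gcongr
        refine (ENNReal.ofReal_le_ofReal (sum_swapWeight_le t)).trans (le_of_eq ?_)
        rw [ENNReal.ofReal_pow two_pos.le, ENNReal.ofReal_ofNat]
    _ ≤ _ := by
        rw [← Finset.mul_sum]
        gcongr
        refine (sum_measure_mem_traces_le h𝒜 hv T
          fun t ht => (Finset.mem_filter.1 ht).2).trans (le_of_eq ?_)
        rw [Fintype.card_prod, Fintype.card_bool, mul_comm]

open Classical in
/-- The number of indices of a trace on the double sample that belong to the first sample
(`b = false`) or to the ghost sample (`b = true`). -/
noncomputable def sampleCard {ι : Type*} [Fintype ι] (t : Finset (ι × Bool)) (b : Bool) : ℝ :=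
  ∑ i, if (i, b) ∈ t then 1 else 0

/-- On the double sample, with high probability no trace has many ghost points and few points of
the first sample: such a trace has swap weight at least `exp θ`. -/
lemma measure_exists_unbalanced_trace_le {d : ℕ} {ι : Type*} [Fintype ι]
    {Q : Measure (EuclideanSpace ℝ (Fin d))} [IsProbabilityMeasure Q]
    {𝒜 : Set (Set (EuclideanSpace ℝ (Fin d)))} (h𝒜 : IsMeasurableClass Q 𝒜) {v : ℕ}
    (hv : vcDim 𝒜 = v) {θ : ℝ} (hθ : 0 < θ) :
    (Measure.pi fun _ => Q) {z : ι × Bool → EuclideanSpace ℝ (Fin d) | ∃ t ∈ traces 𝒜 z,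
        4 * θ ≤ sampleCard t true ∧ 6 * sampleCard t false ≤ sampleCard t true} ≤
      ENNReal.ofReal (Real.exp (-θ)) * ((2 * Fintype.card ι + 1) ^ v : ℕ) := by
  classical
  let T : Finset (Finset (ι × Bool)) := {t | t.Nonempty}
  let R : Finset (ι × Bool) → Prop := fun t =>
    4 * θ ≤ sampleCard t true ∧ 6 * sampleCard t false ≤ sampleCard t true
  let m : Finset (ι × Bool) → ℝ≥0∞ := fun t =>
    (Measure.pi fun _ => Q) {z : ι × Bool → EuclideanSpace ℝ (Fin d) | t ∈ traces 𝒜 z}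
  have hR : ∀ t, R t → t.Nonempty := by
    rintro t ⟨h, -⟩
    rw [Finset.nonempty_iff_ne_empty]
    rintro rfl
    simp [sampleCard] at h
    linarith
  -- on `R` the exponent `(b - 3 a) / 2` is at least `b / 4 ≥ θ`, as `6 a ≤ b`
  have hW : ∀ t, R t → 1 ≤ Real.exp (-θ) * swapWeight t := by
    rintro t ⟨h1, h2⟩
    rw [swapWeight, ← Real.exp_sum, ← Real.exp_add]
    refine Real.one_le_exp ?_
    rw [← Finset.sum_div, Finset.sum_sub_distrib, ← Finset.mul_sum]
    change 0 ≤ -θ + (sampleCard t true - 3 * sampleCard t false) / 2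
    linarith
  calc _ ≤ (Measure.pi fun _ => Q) (⋃ t ∈ T.filter R,
          {z : ι × Bool → EuclideanSpace ℝ (Fin d) | t ∈ traces 𝒜 z}) := by
        refine measure_mono ?_
        rintro z ⟨t, ht, htR⟩
        exact Set.mem_biUnion (by simpa [T] using ⟨hR t htR, htR⟩) ht
    _ ≤ ∑ t ∈ T.filter R, m t := measure_biUnion_finset_le _ _
    _ ≤ ∑ t ∈ T.filter R, ENNReal.ofReal (Real.exp (-θ)) *
          (ENNReal.ofReal (swapWeight t) * m t) := by
        refine Finset.sum_le_sum fun t ht => ?_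
        rw [← mul_assoc, ← ENNReal.ofReal_mul (Real.exp_pos _).le]
        refine le_mul_of_one_le_left zero_le ?_
        rw [← ENNReal.ofReal_one]
        exact ENNReal.ofReal_le_ofReal (hW t (Finset.mem_filter.1 ht).2)
    _ ≤ ∑ t ∈ T, ENNReal.ofReal (Real.exp (-θ)) * (ENNReal.ofReal (swapWeight t) * m t) :=
        Finset.sum_le_sum_of_subset (Finset.filter_subset _ _)
    _ ≤ _ := by
        rw [← Finset.mul_sum]
        gcongr
        exact sum_swapWeight_mul_measure_le h𝒜 hv

/-- Chebyshev's inequality for the number of sample points in a set with expected number at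
least `8`. -/
lemma half_le_measure_count {d n : ℕ} {Q : Measure (EuclideanSpace ℝ (Fin d))}
    [IsProbabilityMeasure Q] {A : Set (EuclideanSpace ℝ (Fin d))} (hA : MeasurableSet A)
    (h8 : 8 ≤ n * Q.real A) :
    2⁻¹ ≤ (Measure.pi fun _ => Q)
      {x : Fin n → EuclideanSpace ℝ (Fin d) | n * Q.real A / 2 ≤ count x A} := by
  set M : ℝ := n * Q.real A with hM
  set f : EuclideanSpace ℝ (Fin d) → ℝ := A.indicator fun _ => 1 with hf
  have hfm : Measurable f := measurable_const.indicator hA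
  have hfL : ∀ p : ℝ≥0∞, MemLp f p Q := fun p =>
    memLp_indicator_const p hA 1 (Or.inr (measure_ne_top _ _))
  have hint : ∫ x, f x ∂Q = Q.real A := by rw [hf, integral_indicator_const _ hA]; simp
  have hmemi : ∀ i : Fin n, MemLp (fun x : Fin n → EuclideanSpace ℝ (Fin d) => f (x i)) 2
      (Measure.pi fun _ => Q) := fun i =>
    (hfL 2).comp_measurePreserving (measurePreserving_eval (fun _ => Q) i)
  have hmem : MemLp (fun x : Fin n → EuclideanSpace ℝ (Fin d) => count x A) 2
      (Measure.pi fun _ => Q) := memLp_finsetSum _ fun i _ => hmemi i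
  have hE : ∫ x : Fin n → EuclideanSpace ℝ (Fin d), count x A ∂(Measure.pi fun _ => Q) = M := by
    simp only [count]
    rw [integral_finsetSum _ fun i _ => (hmemi i).integrable one_le_two]
    have : ∀ i : Fin n, ∫ x : Fin n → EuclideanSpace ℝ (Fin d), f (x i) ∂(Measure.pi fun _ => Q) =
        Q.real A := by
      intro i
      rw [integral_comp_eval (μ := fun _ : Fin n => Q) hfm.aestronglyMeasurable, hint]
    simp [this, hM]
  have hVar : Var[fun x : Fin n → EuclideanSpace ℝ (Fin d) => count x A;
      Measure.pi fun _ => Q] ≤ M := by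
    have h1 : (fun x : Fin n → EuclideanSpace ℝ (Fin d) => count x A) =
        ∑ i, fun x : Fin n → EuclideanSpace ℝ (Fin d) => f (x i) := by
      ext x
      simp [count, hf]
    rw [h1, variance_sum_pi (X := fun _ : Fin n => f) fun i => hfL 2]
    have h2 : Var[f; Q] ≤ Q.real A := by
      refine (variance_le_expectation_sq hfm.aestronglyMeasurable).trans (le_of_eq ?_)
      rw [← hint]
      refine integral_congr_ae (Filter.Eventually.of_forall fun x => ?_)
      by_cases hx : x ∈ A <;> simp [hf, hx]
    calc ∑ _i : Fin n, Var[f; Q] ≤ ∑ _i : Fin n, Q.real A := Finset.sum_le_sum fun _ _ => h2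
      _ = M := by simp [hM]
  have hcheb := meas_ge_le_variance_div_sq hmem (c := M / 2) (by linarith)
  rw [hE] at hcheb
  have hbad : (Measure.pi fun _ => Q)
      {x : Fin n → EuclideanSpace ℝ (Fin d) | M / 2 ≤ count x A}ᶜ ≤ 2⁻¹ := by
    calc _ ≤ (Measure.pi fun _ => Q)
          {x : Fin n → EuclideanSpace ℝ (Fin d) | M / 2 ≤ |count x A - M|} := by
          refine measure_mono fun x hx => ?_
          simp only [Set.mem_compl_iff, Set.mem_ofPred_eq, not_le] at hx ⊢
          rw [abs_of_neg (by linarith)]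
          linarith
      _ ≤ _ := hcheb
      _ ≤ ENNReal.ofReal 2⁻¹ := by
          refine ENNReal.ofReal_le_ofReal ?_
          rw [div_le_iff₀ (by nlinarith)]
          nlinarith
      _ = 2⁻¹ := by rw [ENNReal.ofReal_inv_of_pos two_pos, ENNReal.ofReal_ofNat]
  have hcm : Measurable fun x : Fin n → EuclideanSpace ℝ (Fin d) => count x A :=
    Finset.measurable_sum _ fun i _ => hfm.comp (measurable_pi_apply i)
  have hms : MeasurableSet {x : Fin n → EuclideanSpace ℝ (Fin d) | M / 2 ≤ count x A} :=
    measurableSet_le measurable_const hcm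
  have := prob_add_prob_compl (μ := Measure.pi fun _ : Fin n => Q) hms
  by_contra hc
  push Not at hc
  have h3 := ENNReal.add_lt_add_of_lt_of_le (ne_top_of_le_ne_top (by simp) hbad) hc hbad
  rw [this, ENNReal.inv_two_add_inv_two] at h3
  exact lt_irrefl _ h3

/-- Relative deviation inequality of Vapnik and Chervonenkis, with non-optimal constants: with high
probability, all sets of the class of large enough mass contain at least a twelfth of the expected
number of sample points. No measurability of the event is claimed; the bound is on its outer
measure. -/
lemma measure_exists_count_lt_le {d n : ℕ}
    {Q : Measure (EuclideanSpace ℝ (Fin d))} [IsProbabilityMeasure Q]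
    {𝒜 : Set (Set (EuclideanSpace ℝ (Fin d)))} (h𝒜 : IsMeasurableClass Q 𝒜) {v : ℕ}
    (hv : vcDim 𝒜 = v) {θ : ℝ} (hθ : 1 ≤ θ) :
    (Measure.pi fun _ => Q) {x : Fin n → EuclideanSpace ℝ (Fin d) | ∃ A ∈ 𝒜,
        8 * θ ≤ n * Q.real A ∧ count x A < n * Q.real A / 12} ≤
      2 * (ENNReal.ofReal (Real.exp (-θ)) * ((2 * n + 1) ^ v : ℕ)) := by
  set D : Set (Fin n × Bool → EuclideanSpace ℝ (Fin d)) := {z | ∃ t ∈ traces 𝒜 z,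
        4 * θ ≤ sampleCard t true ∧ 6 * sampleCard t false ≤ sampleCard t true} with hD
  have hDle := measure_exists_unbalanced_trace_le (ι := Fin n) h𝒜 hv (zero_lt_one.trans_le hθ)
  rw [Fintype.card_fin, ← hD] at hDle
  let π := Measure.pi fun _ : Fin n => Q
  let H := toMeasurable (Measure.pi fun _ => Q) D
  have hmp := measurePreserving_doubleSample (ι := Fin n) Q
  have hH : MeasurableSet (doubleSample ⁻¹' H : Set ((Fin n → EuclideanSpace ℝ (Fin d)) × _)) :=
    hmp.measurable (measurableSet_toMeasurable _ _)
  have hsub : {x : Fin n → EuclideanSpace ℝ (Fin d) | ∃ A ∈ 𝒜,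
      8 * θ ≤ n * Q.real A ∧ count x A < n * Q.real A / 12} ⊆
      {x | 2⁻¹ ≤ π (Prod.mk x ⁻¹' (doubleSample ⁻¹' H))} := by
    -- with ghost probability at least `1 / 2`, the ghost count is at least `n Q(A) / 2 ≥ 4 θ`, hence
    -- more than six times the count of the first sample
    rintro x ⟨A, hA, h8, hx⟩
    refine (half_le_measure_count (h𝒜.1 A hA) (by linarith)).trans (measure_mono ?_)
    intro x' hx'
    classical
    refine subset_toMeasurable _ _ ⟨Finset.univ.filter fun p => doubleSample (x, x') p ∈ A,
      mem_traces.2 ⟨A, hA, fun i => by simp⟩, ?_⟩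
    have h1 : sampleCard (Finset.univ.filter fun p => doubleSample (x, x') p ∈ A) true =
        count x' A := by
      simp [sampleCard, doubleSample, count, Set.indicator_apply]
    have h2 : sampleCard (Finset.univ.filter fun p => doubleSample (x, x') p ∈ A) false =
        count x A := by
      simp [sampleCard, doubleSample, count, Set.indicator_apply]
    rw [h1, h2]
    rw [Set.mem_ofPred_eq] at hx'
    constructor <;> linarith
  have hmarkov : 2⁻¹ * π {x | 2⁻¹ ≤ π (Prod.mk x ⁻¹' (doubleSample ⁻¹' H))} ≤
      (Measure.pi fun _ => Q) D := by
    refine (mul_meas_ge_le_lintegral (measurable_measure_prodMk_left hH) _).trans (le_of_eq ?_)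
    rw [← Measure.prod_apply hH, hmp.measure_preimage
      (measurableSet_toMeasurable _ _).nullMeasurableSet, measure_toMeasurable]
  calc _ ≤ π {x | 2⁻¹ ≤ π (Prod.mk x ⁻¹' (doubleSample ⁻¹' H))} := measure_mono hsub
    _ = 2 * (2⁻¹ * π {x | 2⁻¹ ≤ π (Prod.mk x ⁻¹' (doubleSample ⁻¹' H))}) := by
        rw [← mul_assoc, ENNReal.mul_inv_cancel two_ne_zero ENNReal.ofNat_ne_top, one_mul]
    _ ≤ _ := mul_le_mul' le_rfl (hmarkov.trans hDle)

/-! ### Bias and noise of the estimator on one sample -/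

lemma localLipschitzConst_nonneg {d : ℕ} (g : EuclideanSpace ℝ (Fin d) → ℝ)
    (V : Set (EuclideanSpace ℝ (Fin d))) : 0 ≤ localLipschitzConst g V :=
  Real.sInf_nonneg fun _ hK => hK.1

lemma localLipschitzConst_le {d : ℕ} {g : EuclideanSpace ℝ (Fin d) → ℝ}
    {S V : Set (EuclideanSpace ℝ (Fin d))} {L : ℝ≥0} (hg : LipschitzOnWith L g S) (hV : V ⊆ S) :
    localLipschitzConst g V ≤ L := by
  refine csInf_le ⟨0, fun _ hK => hK.1⟩ ⟨L.2, fun x hx y hy => ?_⟩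
  simpa [Real.dist_eq, dist_eq_norm] using hg.dist_le_mul x (hV hx) y (hV hy)

/-- The infimum in the local Lipschitz constant is attained as soon as the set of admissible
constants is nonempty, which the Lipschitz condition on `S` ensures. -/
lemma abs_sub_le_localLipschitzConst_mul {d : ℕ} {g : EuclideanSpace ℝ (Fin d) → ℝ}
    {S V : Set (EuclideanSpace ℝ (Fin d))} {L : ℝ≥0} (hg : LipschitzOnWith L g S) (hV : V ⊆ S)
    {x y : EuclideanSpace ℝ (Fin d)} (hx : x ∈ V) (hy : y ∈ V) :
    |g x - g y| ≤ localLipschitzConst g V * ‖x - y‖ := by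
  rcases (norm_nonneg (x - y)).eq_or_lt with h | h
  · have hxy : x = y := by rwa [eq_comm, norm_eq_zero, sub_eq_zero] at h
    simp [hxy]
  · rw [← div_le_iff₀ h]
    refine le_csInf ⟨L, L.2, fun x hx y hy => ?_⟩ fun K hK => ?_
    · simpa [Real.dist_eq, dist_eq_norm] using hg.dist_le_mul x (hV hx) y (hV hy)
    · rw [div_le_iff₀ h]
      exact hK.2 x hx y hy

lemma abs_estimator_sub_le {d n : ℕ} {X : Fin n → EuclideanSpace ℝ (Fin d)} {Y : Fin n → ℝ}
    {V : EuclideanSpace ℝ (Fin d) → Set (EuclideanSpace ℝ (Fin d))}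
    {x : EuclideanSpace ℝ (Fin d)} (g : EuclideanSpace ℝ (Fin d) → ℝ) {B u : ℝ}
    (hc : 0 < count X (V x)) (hB : ∀ i, X i ∈ V x → |g (X i) - g x| ≤ B)
    (hu : |∑ i, (Y i - g (X i)) * (V x).indicator (fun _ => (1 : ℝ)) (X i)| ≤ u) :
    |estimator X Y V x - g x| ≤ u / count X (V x) + B := by
  set w : Fin n → ℝ := fun i => (V x).indicator (fun _ => (1 : ℝ)) (X i) with hw
  have hw0 : ∀ i, 0 ≤ w i := fun i => Set.indicator_nonneg (fun _ _ => zero_le_one) _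
  have hcount : count X (V x) = ∑ i, w i := rfl
  have hsplit : estimator X Y V x - g x =
      (∑ i, (Y i - g (X i)) * w i) / count X (V x) +
        (∑ i, (g (X i) - g x) * w i) / count X (V x) := by
    rw [← add_div, ← Finset.sum_add_distrib, estimator, eq_div_iff hc.ne', sub_mul,
      div_mul_cancel₀ _ hc.ne', hcount, Finset.mul_sum, ← Finset.sum_sub_distrib]
    exact Finset.sum_congr rfl fun i _ => by ring
  have hbias : |∑ i, (g (X i) - g x) * w i| ≤ B * count X (V x) := by
    rw [hcount, Finset.mul_sum]
    refine (Finset.abs_sum_le_sum_abs _ _).trans (Finset.sum_le_sum fun i _ => ?_)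
    rw [abs_mul, abs_of_nonneg (hw0 i)]
    by_cases hi : X i ∈ V x
    · exact mul_le_mul_of_nonneg_right (hB i hi) (hw0 i)
    · simp [hw, hi]
  rw [hsplit]
  refine (abs_add_le _ _).trans (add_le_add ?_ ?_)
  · rw [abs_div, abs_of_pos hc]
    gcongr
  · rw [abs_div, abs_of_pos hc, div_le_iff₀ hc]
    exact hbias

/-- A shape-regular set of volume of order `r ^ (d / (d + 2))` has diameter of order
`r ^ (1 / (d + 2))`. The factor `1 + a` replaces `a ^ (1 / d)` so as not to depend on `d`. -/
lemma norm_sub_le_of_isShapeRegular {d : ℕ} (hd : 1 ≤ d) {γ a r : ℝ} (hγ : 0 < γ) (ha : 0 < a)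
    (hr : 0 < r) {V : Set (EuclideanSpace ℝ (Fin d))} (hV : IsShapeRegular γ V)
    (hvol : volume V ≤ ENNReal.ofReal (a * r ^ ((d : ℝ) / (d + 2))))
    {x y : EuclideanSpace ℝ (Fin d)} (hx : x ∈ V) (hy : y ∈ V) :
    ‖x - y‖ ≤ (1 + a) * γ ^ (1 / (d : ℝ)) * r ^ (1 / ((d : ℝ) + 2)) := by
  have hd0 : (0 : ℝ) < d := by exact_mod_cast hd
  have hd1 : (1 : ℝ) ≤ d := by exact_mod_cast hd
  have hpow : ‖x - y‖ ^ d ≤ γ * (a * r ^ ((d : ℝ) / (d + 2))) := by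
    have h1 : edist x y ^ d ≤ ENNReal.ofReal γ * ENNReal.ofReal (a * r ^ ((d : ℝ) / (d + 2))) := by
      calc edist x y ^ d ≤ Metric.ediam V ^ d := by
            gcongr
            exact Metric.edist_le_ediam_of_mem hx hy
        _ ≤ ENNReal.ofReal γ * volume V := hV
        _ ≤ _ := by gcongr
    rw [edist_dist, dist_eq_norm, ← ENNReal.ofReal_pow (norm_nonneg _),
      ← ENNReal.ofReal_mul hγ.le] at h1
    exact (ENNReal.ofReal_le_ofReal_iff (by positivity)).1 h1
  have ha1 : a ^ (1 / (d : ℝ)) ≤ 1 + a := by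
    rcases le_total a 1 with h | h
    · have := Real.rpow_le_one ha.le h (by positivity : 0 ≤ 1 / (d : ℝ))
      linarith
    · have := Real.rpow_le_rpow_of_exponent_le h (by rw [div_le_one hd0]; exact hd1 :
        1 / (d : ℝ) ≤ 1)
      rw [Real.rpow_one] at this
      linarith
  calc ‖x - y‖ = (‖x - y‖ ^ d) ^ (1 / (d : ℝ)) := by
        rw [one_div, Real.pow_rpow_inv_natCast (norm_nonneg _) (by omega)]
    _ ≤ (γ * (a * r ^ ((d : ℝ) / (d + 2)))) ^ (1 / (d : ℝ)) := by gcongr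
    _ = a ^ (1 / (d : ℝ)) * γ ^ (1 / (d : ℝ)) * r ^ (1 / ((d : ℝ) + 2)) := by
        rw [Real.mul_rpow hγ.le (by positivity), Real.mul_rpow ha.le (by positivity),
          ← Real.rpow_mul hr.le]
        have : (d : ℝ) / (d + 2) * (1 / d) = 1 / (d + 2) := by field_simp
        rw [this]
        ring
    _ ≤ _ := by gcongr

/-- The noise term: its standard deviation `√(σ² Λ / N)` is of order `r ^ (1 / (d + 2))` when the
local sample size `N` is at least of order `n r ^ (d / (d + 2))`. -/
lemma sqrt_div_le_of_le_count {d : ℕ} {σ ℓ a r Λ N n : ℝ} (hℓ : 0 < ℓ) (ha : 0 < a)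
    (hr : 0 < r) (hn : 0 < n) (hΛ : Λ ≤ 2 * (n * r))
    (hN : n * (ℓ * (a * r ^ ((d : ℝ) / (d + 2)))) / 12 ≤ N) :
    √(2 * σ ^ 2 * N * Λ) / N ≤ 4 / √a * √(3 * σ ^ 2 / ℓ) * r ^ (1 / ((d : ℝ) + 2)) := by
  set ρ := r ^ ((d : ℝ) / (d + 2)) with hρ
  set q := r ^ (1 / ((d : ℝ) + 2)) with hq
  have hρ0 : 0 < ρ := Real.rpow_pos_of_pos hr _
  have hq0 : 0 < q := Real.rpow_pos_of_pos hr _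
  have hN0 : 0 < N := lt_of_lt_of_le (by positivity) hN
  have hrq : r = ρ * q ^ 2 := by
    rw [hρ, hq, ← Real.rpow_natCast, ← Real.rpow_mul hr.le, ← Real.rpow_add hr]
    have : (d : ℝ) / (d + 2) + 1 / (d + 2) * ((2 : ℕ) : ℝ) = 1 := by
      push_cast
      field_simp
    rw [this, Real.rpow_one]
  rw [div_le_iff₀ hN0]
  refine Real.sqrt_le_iff.2 ⟨by positivity, ?_⟩
  have hsq : (4 / √a * √(3 * σ ^ 2 / ℓ) * q * N) ^ 2 = 48 * σ ^ 2 * q ^ 2 / (a * ℓ) * N * N := by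
    rw [mul_pow, mul_pow, mul_pow, div_pow, Real.sq_sqrt ha.le, Real.sq_sqrt (by positivity)]
    field_simp
    ring
  rw [hsq]
  have h1 : 48 * σ ^ 2 * q ^ 2 / (a * ℓ) * (n * (ℓ * (a * ρ)) / 12) = 2 * σ ^ 2 * (2 * (n * r)) := by
    rw [hrq]
    field_simp
    ring
  calc 2 * σ ^ 2 * N * Λ ≤ 2 * σ ^ 2 * N * (2 * (n * r)) := by gcongr
    _ = 48 * σ ^ 2 * q ^ 2 / (a * ℓ) * (n * (ℓ * (a * ρ)) / 12) * N := by rw [h1]; ring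
    _ ≤ _ := by gcongr

/-! ### Probability of the good event -/

lemma withProbAtLeast_of_measure_le {Ω : Type*} [MeasurableSpace Ω] {μ : Measure Ω}
    [IsProbabilityMeasure μ] {q : ℝ} (hq : 0 ≤ q) {A : Ω → Prop}
    (h : μ {ω | ¬A ω} ≤ ENNReal.ofReal q) : WithProbAtLeast μ (1 - q) A := by
  refine ⟨(toMeasurable μ {ω | ¬A ω})ᶜ, (measurableSet_toMeasurable _ _).compl, ?_, fun ω hω => ?_⟩
  · rw [prob_compl_eq_one_sub (measurableSet_toMeasurable _ _), measure_toMeasurable,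
      ENNReal.ofReal_sub _ hq, ENNReal.ofReal_one]
    gcongr
  · by_contra hA
    exact hω (subset_toMeasurable _ _ hA)

lemma WithProbAtLeast.mono {Ω : Type*} [MeasurableSpace Ω] {μ : Measure Ω} {p : ℝ}
    {A B : Ω → Prop} (h : WithProbAtLeast μ p A) (hAB : ∀ ω, A ω → B ω) :
    WithProbAtLeast μ p B := by
  obtain ⟨G, hG, hp, hA⟩ := h
  exact ⟨G, hG, hp, fun ω hω => hAB ω (hA ω hω)⟩

lemma IsIIDSample.map_eq {d n : ℕ} {Ω : Type*} [MeasurableSpace Ω] {μ : Measure Ω}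
    [IsProbabilityMeasure μ] {P : Measure (EuclideanSpace ℝ (Fin d) × ℝ)}
    {X : Fin n → Ω → EuclideanSpace ℝ (Fin d)} {Y : Fin n → Ω → ℝ} (h : IsIIDSample μ P X Y) :
    μ.map (fun ω i => (X i ω, Y i ω)) = Measure.pi fun _ => P := by
  rw [(iIndepFun_iff_map_fun_eq_pi_map fun i => (h.2 i).aemeasurable).1 h.1]
  simp only [fun i => (h.2 i).map_eq]

lemma IsIIDSample.aemeasurable {d n : ℕ} {Ω : Type*} [MeasurableSpace Ω] {μ : Measure Ω}
    {P : Measure (EuclideanSpace ℝ (Fin d) × ℝ)}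
    {X : Fin n → Ω → EuclideanSpace ℝ (Fin d)} {Y : Fin n → Ω → ℝ} (h : IsIIDSample μ P X Y) :
    AEMeasurable (fun ω i => (X i ω, Y i ω)) μ :=
  aemeasurable_pi_lambda _ fun i => (h.2 i).aemeasurable

/-- With probability at least `1 - 3δ`, uniformly over the class: the noise sum over a set is at
most its sub-Gaussian deviation, and a set of large mass contains a proportional number of sample
points. -/
lemma measure_bad_event_le {d n v : ℕ} {δ : ℝ} (hδ : 0 < δ) (hδ' : δ < 1 / 3)
    {σ : ℝ} {Ω : Type*} [MeasurableSpace Ω] {μ : Measure Ω} [IsProbabilityMeasure μ]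
    {P : Measure (EuclideanSpace ℝ (Fin d) × ℝ)} [IsProbabilityMeasure P]
    {g : EuclideanSpace ℝ (Fin d) → ℝ} (hsub : CondSubGaussianNoise P g σ)
    {X : Fin n → Ω → EuclideanSpace ℝ (Fin d)} {Y : Fin n → Ω → ℝ} (hiid : IsIIDSample μ P X Y)
    {𝒜 : Set (Set (EuclideanSpace ℝ (Fin d)))} (hv : vcDim 𝒜 = v)
    (h𝒜 : IsMeasurableClass (P.map Prod.fst) 𝒜) :
    μ {ω | ¬ ∀ A ∈ 𝒜,
      |∑ i, (Y i ω - g (X i ω)) * A.indicator (fun _ => (1 : ℝ)) (X i ω)| ≤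
          √(2 * σ ^ 2 * count (fun i => X i ω) A * Real.log (2 * ((n : ℝ) + 1) ^ v / δ)) ∧
      (8 * Real.log (4 * (2 * (n : ℝ) + 1) ^ v / δ) ≤ n * (P.map Prod.fst).real A →
        n * (P.map Prod.fst).real A / 12 ≤ count (fun i => X i ω) A)} ≤
    ENNReal.ofReal (3 * δ) := by
  classical
  have hfstp : IsProbabilityMeasure (P.map Prod.fst) :=
    Measure.isProbabilityMeasure_map measurable_fst.aemeasurable
  obtain ⟨ε, hε, hεg, hdom⟩ := hsub.exists_mgfDominated
  set Λ := Real.log (2 * ((n : ℝ) + 1) ^ v / δ) with hΛ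
  set θ := Real.log (4 * (2 * (n : ℝ) + 1) ^ v / δ) with hθ
  have hp1 : (1 : ℝ) ≤ ((n : ℝ) + 1) ^ v := one_le_pow₀ (by linarith [n.cast_nonneg (α := ℝ)])
  have hp2 : (1 : ℝ) ≤ (2 * (n : ℝ) + 1) ^ v := one_le_pow₀ (by linarith [n.cast_nonneg (α := ℝ)])
  have hΛ0 : 0 ≤ Λ := Real.log_nonneg (by rw [le_div_iff₀ hδ]; linarith)
  -- as `δ < 1 / 3`, the argument of this logarithm exceeds `12 > exp 1`
  have hθ1 : 1 ≤ θ := by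
    rw [hθ, Real.le_log_iff_exp_le (by positivity), le_div_iff₀ hδ]
    have := Real.exp_one_lt_d9
    nlinarith [Real.exp_pos 1]
  have hexpΛ : Real.exp (-Λ) = δ / (2 * ((n : ℝ) + 1) ^ v) := by
    rw [Real.exp_neg, hΛ, Real.exp_log (by positivity), inv_div]
  have hexpθ : Real.exp (-θ) = δ / (4 * (2 * (n : ℝ) + 1) ^ v) := by
    rw [Real.exp_neg, hθ, Real.exp_log (by positivity), inv_div]
  let B₁ : Set (Fin n → EuclideanSpace ℝ (Fin d) × ℝ) := {p | ∃ t ∈ traces 𝒜 fun i => (p i).1,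
    √(2 * σ ^ 2 * t.card * Λ) < |∑ i ∈ t, ε (p i)|}
  let B₂ : Set (Fin n → EuclideanSpace ℝ (Fin d)) := {x | ∃ A ∈ 𝒜,
    8 * θ ≤ n * (P.map Prod.fst).real A ∧ count x A < n * (P.map Prod.fst).real A / 12}
  have hμ₁ : μ ((fun ω i => (X i ω, Y i ω)) ⁻¹' B₁) ≤ ENNReal.ofReal δ := by
    refine (Measure.le_map_apply hiid.aemeasurable _).trans ?_
    rw [hiid.map_eq]
    refine (measure_exists_trace_noise_le hε hdom h𝒜 hv hΛ0).trans (le_of_eq ?_)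
    rw [hexpΛ, Fintype.card_fin, ← ENNReal.ofReal_natCast, ← ENNReal.ofReal_ofNat 2,
      ← ENNReal.ofReal_mul two_pos.le, ← ENNReal.ofReal_mul (by positivity)]
    congr 1
    push_cast
    field_simp
  have hμ₂ : μ ((fun ω i => X i ω) ⁻¹' B₂) ≤ ENNReal.ofReal (δ / 2) := by
    have hfst : Measurable fun (p : Fin n → EuclideanSpace ℝ (Fin d) × ℝ) i => (p i).1 := by
      fun_prop
    have hmap : μ.map (fun ω i => X i ω) = Measure.pi fun _ => P.map Prod.fst := by
      rw [← Measure.pi_map_pi fun i => measurable_fst.aemeasurable, ← hiid.map_eq,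
        AEMeasurable.map_map_of_aemeasurable hfst.aemeasurable hiid.aemeasurable]
      rfl
    refine (Measure.le_map_apply (hfst.comp_aemeasurable hiid.aemeasurable) _).trans ?_
    change μ.map (fun ω i => X i ω) B₂ ≤ _
    rw [hmap]
    refine (measure_exists_count_lt_le h𝒜 hv hθ1).trans (le_of_eq ?_)
    rw [hexpθ, ← ENNReal.ofReal_natCast, ← ENNReal.ofReal_ofNat 2,
      ← ENNReal.ofReal_mul (by positivity), ← ENNReal.ofReal_mul two_pos.le]
    congr 1
    push_cast
    field_simp
    norm_num
  have hae : ∀ᵐ ω ∂μ, ∀ i, Y i ω - g (X i ω) = ε (X i ω, Y i ω) := by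
    refine ae_all_iff.2 fun i => ?_
    have h := hεg
    rw [← (hiid.2 i).map_eq] at h
    exact ae_of_ae_map (hiid.2 i).aemeasurable h
  calc _ ≤ μ (((fun ω i => (X i ω, Y i ω)) ⁻¹' B₁ ∪ (fun ω i => X i ω) ⁻¹' B₂) ∪
        {ω | ¬ ∀ i, Y i ω - g (X i ω) = ε (X i ω, Y i ω)}) := by
        refine measure_mono fun ω hω => ?_
        by_contra hc
        simp only [Set.mem_union, not_or, Set.mem_ofPred_eq, not_not] at hc
        obtain ⟨⟨h1, h2⟩, h3⟩ := hc
        refine hω fun A hA => ⟨?_, fun h8 => ?_⟩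
        · by_contra hlt
          push Not at hlt
          refine h1 ⟨Finset.univ.filter fun i => X i ω ∈ A, mem_traces.2 ⟨A, hA, by simp⟩, ?_⟩
          have hcount : ((Finset.univ.filter fun i => X i ω ∈ A).card : ℝ) =
              count (fun i => X i ω) A := by
            simp [count, Set.indicator_apply]
          have hsum : ∑ i ∈ Finset.univ.filter (fun i => X i ω ∈ A), ε (X i ω, Y i ω) =
              ∑ i, (Y i ω - g (X i ω)) * A.indicator (fun _ => (1 : ℝ)) (X i ω) := by
            simp [h3, Set.indicator_apply, Finset.sum_filter]
          rw [hcount, hsum]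
          exact hlt
        · by_contra hlt
          push Not at hlt
          exact h2 ⟨A, hA, h8, hlt⟩
    _ ≤ (ENNReal.ofReal δ + ENNReal.ofReal (δ / 2)) + 0 :=
        (measure_union_le _ _).trans (add_le_add ((measure_union_le _ _).trans
          (add_le_add hμ₁ hμ₂)) (ae_iff.1 hae).le)
    _ ≤ _ := by
        rw [add_zero, ← ENNReal.ofReal_add hδ.le (by positivity)]
        exact ENNReal.ofReal_le_ofReal (by linarith)

/-- The local sample size is at least a twelfth of `n P(A)` for every large set `A`: either `A` has
large mass and the relative deviation bound applies, or the empirical measure dominates. -/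
lemma le_count_of_large {d n : ℕ} (hn : 1 ≤ n) {X : Fin n → EuclideanSpace ℝ (Fin d)}
    {A : Set (EuclideanSpace ℝ (Fin d))} {m θ : ℝ} (hm : 0 ≤ m)
    (hlarge : 8 * θ ≤ n * max (empiricalMeasure X A) m)
    (hdev : 8 * θ ≤ n * m → n * m / 12 ≤ count X A) : n * m / 12 ≤ count X A := by
  have hn0 : (0 : ℝ) < n := by exact_mod_cast hn
  rcases le_total (empiricalMeasure X A) m with h | h
  · rw [max_eq_right h] at hlarge
    exact hdev hlarge
  · rw [empiricalMeasure, le_div_iff₀ hn0] at h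
    nlinarith [mul_nonneg hn0.le hm]

/-! ### The rate of convergence -/

/-- The error bound at one point, on one realisation of the sample for which the noise sum over the
cell and the mass of the cell relative to its sample count are under control. -/
lemma abs_estimator_sub_le_rate {d n v : ℕ} (hd : 1 ≤ d) (hn : 1 ≤ n) {δ : ℝ} (hδ : 0 < δ)
    (hδ' : δ < 1 / 3) {a₁ a₂ : ℝ} (ha₁ : 0 < a₁) (ha₂ : 0 < a₂) {σ γ : ℝ} (hγ : 0 < γ) {L : ℝ≥0}
    {Q : Measure (EuclideanSpace ℝ (Fin d))} [IsProbabilityMeasure Q]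
    {S : Set (EuclideanSpace ℝ (Fin d))} {g : EuclideanSpace ℝ (Fin d) → ℝ}
    (hg : LipschitzOnWith L g S) {X : Fin n → EuclideanSpace ℝ (Fin d)} {Y : Fin n → ℝ}
    {V : EuclideanSpace ℝ (Fin d) → Set (EuclideanSpace ℝ (Fin d))} (hV : IsLocalMap S V)
    {x : EuclideanSpace ℝ (Fin d)} (hx : x ∈ S) {ℓ : ℝ} (hℓ : 0 < ℓ)
    (hmass : ENNReal.ofReal ℓ * volume (V x) ≤ Q (V x))
    (hlarge : 8 * Real.log (4 * (2 * (n : ℝ) + 1) ^ v / δ) ≤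
      n * max (empiricalMeasure X (V x)) (Q.real (V x)))
    (hshape : IsShapeRegular γ (V x))
    (hvol₁ : ENNReal.ofReal (a₁ * logRatio n v δ ^ ((d : ℝ) / ((d : ℝ) + 2))) ≤ volume (V x))
    (hvol₂ : volume (V x) ≤ ENNReal.ofReal (a₂ * logRatio n v δ ^ ((d : ℝ) / ((d : ℝ) + 2))))
    (hnoise : |∑ i, (Y i - g (X i)) * (V x).indicator (fun _ => (1 : ℝ)) (X i)| ≤
      √(2 * σ ^ 2 * count X (V x) * Real.log (2 * ((n : ℝ) + 1) ^ v / δ)))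
    (hdev : 8 * Real.log (4 * (2 * (n : ℝ) + 1) ^ v / δ) ≤ n * Q.real (V x) →
      n * Q.real (V x) / 12 ≤ count X (V x)) :
    |estimator X Y V x - g x| ≤ (4 / √a₁ + (1 + a₂)) *
      (√(3 * σ ^ 2 / ℓ) + localLipschitzConst g (V x) * γ ^ (1 / (d : ℝ))) *
        logRatio n v δ ^ (1 / ((d : ℝ) + 2)) := by
  obtain ⟨hxV, hVS, -⟩ := hV x hx
  have hn0 : (0 : ℝ) < n := by exact_mod_cast hn
  have hp1 : (1 : ℝ) ≤ ((n : ℝ) + 1) ^ v := one_le_pow₀ (by linarith)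
  -- this lets the factor `2` of the two-sided bound be absorbed in `log (2 p / δ) ≤ 2 log (p / δ)`
  have hratio : (2 : ℝ) ≤ ((n : ℝ) + 1) ^ v / δ := by
    rw [le_div_iff₀ hδ]
    linarith
  set r := logRatio n v δ with hr
  have hnr : n * r = Real.log (((n : ℝ) + 1) ^ v / δ) := by
    rw [hr, logRatio]
    field_simp
  have hr0 : 0 < r := by
    have : 0 < n * r := hnr ▸ Real.log_pos (by linarith)
    exact pos_of_mul_pos_right this hn0.le
  have hΛ : Real.log (2 * ((n : ℝ) + 1) ^ v / δ) ≤ 2 * (n * r) := by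
    rw [hnr, mul_div_assoc, Real.log_mul two_ne_zero (by positivity)]
    have := Real.log_le_log two_pos hratio
    linarith
  have hQ : ℓ * (a₁ * r ^ ((d : ℝ) / (d + 2))) ≤ Q.real (V x) := by
    rw [Measure.real, ← ENNReal.ofReal_le_iff_le_toReal (measure_ne_top _ _),
      ENNReal.ofReal_mul hℓ.le]
    exact (mul_le_mul' le_rfl hvol₁).trans hmass
  have hN : n * (ℓ * (a₁ * r ^ ((d : ℝ) / (d + 2)))) / 12 ≤ count X (V x) := by
    refine le_trans ?_ (le_count_of_large hn measureReal_nonneg hlarge hdev)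
    gcongr
  have hcount : 0 < count X (V x) := lt_of_lt_of_le (by positivity) hN
  have hK := localLipschitzConst_nonneg g (V x)
  have hbias : ∀ i, X i ∈ V x → |g (X i) - g x| ≤ localLipschitzConst g (V x) *
      ((1 + a₂) * γ ^ (1 / (d : ℝ)) * r ^ (1 / ((d : ℝ) + 2))) := fun i hi =>
    (abs_sub_le_localLipschitzConst_mul hg hVS hi hxV).trans (mul_le_mul_of_nonneg_left
      (norm_sub_le_of_isShapeRegular hd hγ ha₂ hr0 hshape hvol₂ hi hxV) hK)
  refine (abs_estimator_sub_le g hcount hbias hnoise).trans ?_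
  have hsd := sqrt_div_le_of_le_count (d := d) (σ := σ) hℓ ha₁ hr0 hn0 hΛ hN
  -- the cross terms of the product of the two sums
  have h1 : 0 ≤ 4 / √a₁ * (localLipschitzConst g (V x) * γ ^ (1 / (d : ℝ))) *
      r ^ (1 / ((d : ℝ) + 2)) := by positivity
  have h2 : 0 ≤ (1 + a₂) * √(3 * σ ^ 2 / ℓ) * r ^ (1 / ((d : ℝ) + 2)) := by positivity
  linarith

end LocalMapRegression

theorem mainTheorem1 (a₁ a₂ : ℝ) (ha₁ : 0 < a₁) (ha₂ : 0 < a₂) :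
    ∃ C : ℝ, 0 < C ∧
      ∀ (d n v : ℕ) (_ : 1 ≤ d) (_ : 1 ≤ n)
        (δ : ℝ) (_ : 0 < δ) (_ : δ < 1 / 3)
        (σ γ : ℝ) (_ : 0 < γ) (L : ℝ≥0)
        (Ω : Type*) [MeasurableSpace Ω] (μ : Measure Ω) [IsProbabilityMeasure μ]
        (P : Measure (EuclideanSpace ℝ (Fin d) × ℝ)) [IsProbabilityMeasure P]
        (S : Set (EuclideanSpace ℝ (Fin d))) (_ : MeasurableSet S) (_ : ∀ᵐ p ∂P, p.1 ∈ S)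
        (g : EuclideanSpace ℝ (Fin d) → ℝ)
        (_ : LocalMapRegression.IsRegressionFunction P g)
        (_ : LocalMapRegression.CondSubGaussianNoise P g σ)
        (_ : LipschitzOnWith L g S)
        (X : Fin n → Ω → EuclideanSpace ℝ (Fin d)) (Y : Fin n → Ω → ℝ)
        (_ : LocalMapRegression.IsIIDSample μ P X Y)
        (V : Ω → EuclideanSpace ℝ (Fin d) → Set (EuclideanSpace ℝ (Fin d)))
        (_ : ∀ᵐ ω ∂μ, LocalMapRegression.IsLocalMap S (V ω))
        (_ : LocalMapRegression.IsVCLocalMap μ (P.map Prod.fst) S V v)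
        (ℓ : EuclideanSpace ℝ (Fin d) → ℝ)
        (_ : LocalMapRegression.MinimalMass μ (P.map Prod.fst) S V ℓ)
        (_ : LocalMapRegression.IsLarge μ (P.map Prod.fst) S X V v δ)
        (_ : ∀ᵐ ω ∂μ, ∀ x ∈ S, LocalMapRegression.IsShapeRegular γ (V ω x))
        (_ : ∀ᵐ ω ∂μ, ∀ x ∈ S,
          ENNReal.ofReal
              (a₁ * LocalMapRegression.logRatio n v δ ^ ((d : ℝ) / ((d : ℝ) + 2))) ≤
            volume (V ω x) ∧
          volume (V ω x) ≤
            ENNReal.ofReal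
              (a₂ * LocalMapRegression.logRatio n v δ ^ ((d : ℝ) / ((d : ℝ) + 2)))),
        LocalMapRegression.WithProbAtLeast μ (1 - 3 * δ) (fun ω => ∀ x ∈ S,
          |LocalMapRegression.estimator (fun i => X i ω) (fun i => Y i ω) (V ω) x - g x| ≤
            C * (√(3 * σ ^ 2 / ℓ x) +
                LocalMapRegression.localLipschitzConst g (V ω x) * γ ^ (1 / (d : ℝ))) *
              LocalMapRegression.logRatio n v δ ^ (1 / ((d : ℝ) + 2))) ∧
        ∀ b : ℝ, 0 < b → Bornology.IsBounded S → (∀ x ∈ S, b ≤ ℓ x) →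
          LocalMapRegression.WithProbAtLeast μ (1 - 3 * δ) (fun ω =>
            ⨆ x ∈ S, ENNReal.ofReal
                |LocalMapRegression.estimator (fun i => X i ω) (fun i => Y i ω) (V ω) x - g x| ≤
              ENNReal.ofReal
                (C * (√(3 * σ ^ 2 / b) + L * γ ^ (1 / (d : ℝ))) *
                  LocalMapRegression.logRatio n v δ ^ (1 / ((d : ℝ) + 2)))) := by
  refine ⟨4 / √a₁ + (1 + a₂), by positivity, ?_⟩
  intro d n v hd hn δ hδ hδ' σ γ hγ L Ω _ μ _ P _ S _ _ g _ hsub hg X Y hiid V hV hVC ℓ hmass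
    hlarge hshape hvol
  obtain ⟨𝒜, hv, h𝒜, hV𝒜⟩ := hVC
  have hfstp : IsProbabilityMeasure (P.map Prod.fst) :=
    Measure.isProbabilityMeasure_map measurable_fst.aemeasurable
  have hmain : LocalMapRegression.WithProbAtLeast μ (1 - 3 * δ) (fun ω =>
      LocalMapRegression.IsLocalMap S (V ω) ∧ ∀ x ∈ S,
        |LocalMapRegression.estimator (fun i => X i ω) (fun i => Y i ω) (V ω) x - g x| ≤
          (4 / √a₁ + (1 + a₂)) * (√(3 * σ ^ 2 / ℓ x) +
            LocalMapRegression.localLipschitzConst g (V ω x) * γ ^ (1 / (d : ℝ))) *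
              LocalMapRegression.logRatio n v δ ^ (1 / ((d : ℝ) + 2))) := by
    refine LocalMapRegression.withProbAtLeast_of_measure_le (by positivity) ?_
    -- off a null set, failure of the error bound forces the bad event
    refine le_trans (measure_mono_ae ?_)
      (LocalMapRegression.measure_bad_event_le hδ hδ' hsub hiid hv h𝒜)
    filter_upwards [hV, hV𝒜, hmass.2, hlarge, hshape, hvol] with ω h1 h2 h3 h4 h5 h6
    refine mt fun hω => ⟨h1, fun x hx => ?_⟩
    exact LocalMapRegression.abs_estimator_sub_le_rate hd hn hδ hδ' ha₁ ha₂ hγ hg h1 hx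
      (hmass.1 x hx) (h3 x hx) (h4 x hx) (h5 x hx) (h6 x hx).1 (h6 x hx).2
      (hω _ (h2 x hx)).1 (hω _ (h2 x hx)).2
  refine ⟨hmain.mono fun ω hω => hω.2, fun b hb _ hbℓ => hmain.mono fun ω hω => ?_⟩
  refine iSup₂_le fun x hx => ENNReal.ofReal_le_ofReal ((hω.2 x hx).trans ?_)
  have hr : 0 ≤ LocalMapRegression.logRatio n v δ := by
    refine div_nonneg (Real.log_nonneg ?_) n.cast_nonneg
    have : (1 : ℝ) ≤ ((n : ℝ) + 1) ^ v := one_le_pow₀ (by linarith [n.cast_nonneg (α := ℝ)])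
    rw [le_div_iff₀ hδ]
    linarith
  have hL : LocalMapRegression.localLipschitzConst g (V ω x) ≤ L :=
    LocalMapRegression.localLipschitzConst_le hg (hω.1 x hx).2.1
  have hsqrt : √(3 * σ ^ 2 / ℓ x) ≤ √(3 * σ ^ 2 / b) := by
    have := hbℓ x hx
    gcongr
  gcongr
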